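/- Write $\lg=\log_2$. An \emph{ordinal tree} is a finite rooted tree in which the children of every node are linearly ordered; $|t|\ge 1$ is its number of nodes. $\mathit{BP}(t)\in\{0,1\}^{2|t|}$ denotes its balanced-parenthesis sequence and $\gamma(x)$ the Elias gamma code of $x\ge1$, of length $2\lfloor\lg x\rfloor+1$. \textbf{Shape entropy.} The modified first-child next-sibling encoding $\mathrm{fcns}^\diamond$ maps ordinal forests to full binary trees: the empty forest goes to a single leaf, and the forest whose first tree has root subforest $f$ and whose remaining trees form $g$ goes to an inner node with left subtree $\mathrm{fcns}^\diamond(f)$ and right subtree $\mathrm{fcns}^\diamond(g)$. For a node $v$ of a full binary tree $b$ let $h(v)\in\{0,1\}^*$ be the sequence of directions ($0$ left, $1$ right) from the root to $v$, let $h_k(v)$ be the suffix of length $k$ of $0^kh(v)$, and let $\mathrm{type}(v)\in\{0,2\}$ be its number of children. Let $m_z$ be the number of nodes with $h_k(v)=z$, and $m_{z,i}$ the number of those that also have type $i$. For $k\ge 0$ put $$\mathcal H_k^s(b)=\sum_{z\in\{0,1\}^k}\sum_{i\in\{0,2\}}m_{z,i}\lg\frac{m_z}{m_{z,i}}\qquad(0\lg(x/0)=0),\qquad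 \mathcal H_k^s(t)=\mathcal H_k^s(\mathrm{fcns}^\diamond(t))\ \text{ for an ordinal tree } t .$$ \textbf{Tree covering.} Let $t$ be an ordinal tree with $n$ nodes and $B=\lceil\frac18\lg n\rceil$. A node is \emph{heavy} if its fringe subtree has at least $B$ nodes, and \emph{branching} if it has at least two heavy children. The Farzan--Munro algorithm treats the nodes bottom-up; every node $v$ returns either one \emph{active} component with root $v$ and fewer than $B$ nodes, or only \emph{permanent} components with root $v$. At a branching node the active components of the heavy children are declared permanent. Then the children of $v$ are packed greedily from left to right: a component starts as $\{v\}$ and absorbs active components of children until it has at least $B$ nodes; after that, and at a branching node also whenever a heavy child is passed, the next active component of a child goes to a new component $\{v\}$. Children with permanent components are skipped (so at a node with exactly one heavy child a component may extend across the gap left by that child). A component is never started without an active component to absorb, except that $v$ forms the component $\{v\}$ if no child has an active component. If this gives a single component, it has fewer than $B$ nodes, and $v$ is not branching, then it is passed up as active; otherwise all components with root $v$ become permanent. At the root of $t$ everything becomes permanent. The permanent components are the micro trees $\mu_1,\dots,\mu_m$. Apart from edges leaving the root, at most one (external) edge leaves a micro tree; the gap just described also counts as its external edge. \textbf{Hypersuccinct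 code.} The top tier $\Upsilon$ is the ordinal tree with $m+1$ nodes consisting of a dummy root and the micro trees: the micro trees that contain the root of $t$ are the children of the dummy root; all micro trees with root $u\neq$ root of $t$ are consecutive children of one micro tree that contains the parent $v$ of $u$ (if several micro trees have root $v$, the one whose block of children of $v$ is the last that starts left of $u$, or the first one if there is none). A parent edge is of one of five types: the child's root lies before all / after all children of the parent's root in the parent micro tree, and is new or is shared with the preceding sibling micro tree (four types); or it is an external-edge child (all other cases, including the children of the dummy root). The portal of a micro tree is given by the local preorder rank of the node from which the external edge leaves and the local child rank at which it is to be inserted. Let $C$ be a Huffman code (ties broken arbitrarily) for the string of micro tree shapes $\mu_1,\dots,\mu_m$, and $\bar C$ its length-restricted version: $\bar C(s)=0\cdot\gamma(|s|+1)\cdot\mathit{BP}(s)$ if $|C(s)|>2|s|+2\lfloor\lg(|s|+1)\rfloor$, and $\bar C(s)=1\cdot C(s)$ otherwise. The codeword $\mathsf H(t)\in\{0,1\}^*$ is the concatenation of: $\gamma(n)$ and $\gamma(m)$; $\mathit{BP}(\Upsilon)$; a table of $\bar C$, namely $\gamma$ of the number of distinct micro tree shapes and, for each such shape $s$, $\gamma(|\bar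 C(s)|)$, $\bar C(s)$, $\gamma(|s|)$ and $\mathit{BP}(s)$; then, each time over all micro trees in depth-first order of $\Upsilon$, the codewords $\bar C(\mu_i)$; the portals, as two integers of $\lceil\lg(2B+1)\rceil$ bits each ($(0,0)$ if there is none); and the types of the parent edges, $3$ bits each. \textbf{Claim.} There is an absolute constant $c$ such that, for every hypersuccinct code $\mathsf H$ as above (whatever the tie-breaking), every integer $k\ge 0$ and every ordinal tree $t$ of size $n\ge 3$, $$|\mathsf H(t)|\;\le\;\mathcal H_k^s(t)+c\cdot\frac{n\log\log n+kn}{\log n}.$$ -/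

import Mathlib

namespace Hypersuccinct

/-! ### Trees -/

/-- Ordinal trees: every node has a possibly empty sequence of children. -/
inductive OrdinalTree : Type
  | node (children : List OrdinalTree) : OrdinalTree

noncomputable instance : DecidableEq OrdinalTree := Classical.decEq _

namespace OrdinalTree

mutual
/-- Number of nodes of an ordinal tree. -/
def size : OrdinalTree → ℕ
  | node ts => 1 + sizeForest ts
/-- Number of nodes of an ordinal forest. -/
def sizeForest : List OrdinalTree → ℕ
  | [] => 0
  | t :: ts => size t + sizeForest ts
end

mutual
/-- Balanced-parenthesis sequence of an ordinal tree; `true` is the opening parenthesis. -/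
def bp : OrdinalTree → List Bool
  | node ts => true :: (bpForest ts ++ [false])
/-- Balanced-parenthesis sequence of an ordinal forest. -/
def bpForest : List OrdinalTree → List Bool
  | [] => []
  | t :: ts => bp t ++ bpForest ts
end

end OrdinalTree

/-- Full binary trees: every node is a leaf or has a left and a right child. -/
inductive FullBinaryTree : Type
  | leaf : FullBinaryTree
  | node (left right : FullBinaryTree) : FullBinaryTree

/-! ### Shape entropy -/

/-- The modified first-child next-sibling encoding of ordinal forests:
the empty forest becomes a leaf, and a forest with first tree `node f` and remaining trees `g`
becomes an inner node over the encodings of `f` and `g`. -/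
def fcns : List OrdinalTree → FullBinaryTree
  | [] => .leaf
  | .node f :: g => .node (fcns f) (fcns g)

/-- The nodes `v` of a full binary tree in preorder, each given as the pair of its shape history
(the directions on the path from the root to `v`, `false` for left and `true` for right) and its
type (its number of children, `0` or `2`). The root of the tree has history `h`. -/
def FullBinaryTree.nodes (h : List Bool) : FullBinaryTree → List (List Bool × ℕ)
  | .leaf => [(h, 0)]
  | .node l r => (h, 2) :: (l.nodes (h ++ [false]) ++ r.nodes (h ++ [true]))

/-- The `k`-th order shape history: the suffix of length `k` of `0^k h`. -/
def kHistory (k : ℕ) (h : List Bool) : List Bool :=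
  (List.replicate k false ++ h).drop h.length

/-- `m_z`: the number of nodes with `k`-th order shape history `z`. -/
def FullBinaryTree.numHist (b : FullBinaryTree) (k : ℕ) (z : Fin k → Bool) : ℕ :=
  (b.nodes []).countP fun v => kHistory k v.1 = List.ofFn z

/-- `m_{z,i}`: the number of nodes with `k`-th order shape history `z` and type `i`. -/
def FullBinaryTree.numHistType (b : FullBinaryTree) (k : ℕ) (z : Fin k → Bool) (i : ℕ) : ℕ :=
  (b.nodes []).countP fun v => kHistory k v.1 = List.ofFn z ∧ v.2 = i

/-- The (unnormalized) `k`-th order shape entropy of a full binary tree, with `0 lg (x/0) = 0`. -/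
noncomputable def FullBinaryTree.shapeEntropy (k : ℕ) (b : FullBinaryTree) : ℝ :=
  ∑ z : Fin k → Bool, ∑ i ∈ ({0, 2} : Finset ℕ),
    (b.numHistType k z i : ℝ) * Real.logb 2 ((b.numHist k z : ℝ) / (b.numHistType k z i : ℝ))

/-- The (unnormalized) `k`-th order shape entropy of an ordinal tree. -/
noncomputable def OrdinalTree.shapeEntropy (k : ℕ) (t : OrdinalTree) : ℝ :=
  (fcns [t]).shapeEntropy k

/-! ### Elementary codes -/

/-- Elias gamma code of `n ≥ 1`: `⌊lg n⌋` zeros, then `n` in binary. -/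
def eliasGamma (n : ℕ) : List Bool :=
  List.replicate (Nat.log 2 n) false ++ n.bits.reverse

/-- The lowest `w` binary digits of `x`. -/
def fixedWidth (w x : ℕ) : List Bool :=
  (List.range w).map fun i => x.testBit i

/-- The length-restricted version of a code for ordinal trees. -/
def lengthRestrict (C : OrdinalTree → List Bool) (t : OrdinalTree) : List Bool :=
  if 2 * t.size + 2 * Nat.log 2 (t.size + 1) < (C t).length then
    false :: (eliasGamma (t.size + 1) ++ t.bp)
  else
    true :: C t

/-! ### Huffman codes -/

/-- Binary code trees whose leaves carry a symbol and its frequency. -/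
inductive CodeTree (α : Type) : Type
  | leaf (a : α) (freq : ℕ) : CodeTree α
  | node (left right : CodeTree α) : CodeTree α

namespace CodeTree

variable {α : Type}

/-- Total frequency of the symbols in a code tree. -/
def weight : CodeTree α → ℕ
  | leaf _ f => f
  | node l r => l.weight + r.weight

/-- The symbols of a code tree with their codewords (root-to-leaf paths). -/
def codewords : CodeTree α → List (α × List Bool)
  | leaf a _ => [(a, [])]
  | node l r => l.codewords.map (fun p => (p.1, false :: p.2)) ++
      r.codewords.map (fun p => (p.1, true :: p.2))

/-- The codeword of a symbol; the empty word for symbols that do not occur in the tree. -/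
def code [DecidableEq α] (T : CodeTree α) (a : α) : List Bool :=
  (T.codewords.lookup a).getD []

end CodeTree

/-- `HuffmanMerge S T`: repeatedly replacing two trees of least weight in `S` by a tree that has
them as its children can lead to the single tree `T`. Ties may be broken in any way. -/
inductive HuffmanMerge {α : Type} : Multiset (CodeTree α) → CodeTree α → Prop
  | single (T : CodeTree α) : HuffmanMerge {T} T
  | merge (x y : CodeTree α) (S : Multiset (CodeTree α)) (T : CodeTree α)
      (hxy : x.weight ≤ y.weight) (hy : ∀ z ∈ S, y.weight ≤ z.weight)
      (h : HuffmanMerge (CodeTree.node x y ::ₘ S) T) : HuffmanMerge (x ::ₘ y ::ₘ S) T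

/-- `T` is a Huffman tree for the string `s`: it arises by Huffman's algorithm from the symbols
occurring in `s`, weighted by their numbers of occurrences. -/
def IsHuffmanTree {α : Type} [DecidableEq α] (s : List α) (T : CodeTree α) : Prop :=
  HuffmanMerge ((s.dedup.map fun a => CodeTree.leaf a (s.count a) : List (CodeTree α)) :
    Multiset (CodeTree α)) T

/-! ### The Farzan-Munro decomposition -/

/-- The type of the edge from a micro tree to its parent in the top tier. -/
inductive EdgeType : Type
  | newLeftmost | contLeftmost | newRightmost | contRightmost | external

/-- The top tier below a micro tree: the type of the edge to its parent, its local shape, its portal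
(local preorder rank, counted from `1`, of the node from which the external edge leaves, and the
number of local children of that node to the left of the external edge), and the child micro
trees. -/
inductive TopTree : Type
  | node (edge : EdgeType) (shape : OrdinalTree) (portal : Option (ℕ × ℕ))
      (children : List TopTree) : TopTree

/-- Set the type of the parent edge of a micro tree. -/
def TopTree.setEdge (e : EdgeType) : TopTree → TopTree
  | .node _ s p cs => .node e s p cs

/-- A component that is not yet permanent: its local shape and, if there is an external edge, the
portal together with the permanent components (sharing one root) to which the edge leads. -/
structure Active : Type where
  shape : OrdinalTree
  ext : Option ((ℕ × ℕ) × List TopTree)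

/-- A child of a node `v` as seen when the components of `v` are formed: its component is either
still active, or the child is the common root of a list of permanent components. -/
inductive Entry : Type
  | active (a : Active) : Entry
  | permanent (ts : List TopTree) : Entry

namespace Entry

/-- Whether the component of the child is active. -/
def isActive : Entry → Bool
  | active _ => true
  | permanent _ => false

/-- The local shape that the child contributes to a component. -/
def shape? : Entry → Option OrdinalTree
  | active a => some a.shape
  | permanent _ => none

end Entry

/-- Local shape of the component that consists of `v` and the active components in `es`. -/
def blockShape (es : List Entry) : OrdinalTree := .node (es.filterMap Entry.shape?)

/-- The external edge of the component formed by `v` and the active components in `es`: it either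
leads from `v` to a permanent child or is the external edge of an active component. Here `rank` and
`child` are the numbers of local nodes and of local children of `v` that have been passed. -/
def blockExt (rank child : ℕ) : List Entry → Option ((ℕ × ℕ) × List TopTree)
  | [] => none
  | .permanent ts :: _ => some ((1, child), ts)
  | .active a :: es =>
    match a.ext with
    | some ((r, c), ts) => some ((rank + r, c), ts)
    | none => blockExt (rank + a.shape.size) (child + 1) es

/-- Pass the component formed by `v` and the active components in `es` up the tree. -/
def passUp (es : List Entry) : Active := ⟨blockShape es, blockExt 1 0 es⟩

/-- Components that share their root become children in the top tier: the first one by an edge of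
type `new`, the others by edges of type `cont`. -/
def link (new cont : EdgeType) : List TopTree → List TopTree
  | [] => []
  | T :: Ts => T.setEdge new :: Ts.map (TopTree.setEdge cont)

/-- Link the permanent components below several children of `v`. -/
def linkAll (new cont : EdgeType) (es : List Entry) : List TopTree :=
  es.flatMap fun
    | .active _ => []
    | .permanent ts => link new cont ts

/-- Declare the component with root `v` formed by the entries `es` permanent. Permanent children of
`v` before (after) all local children of `v` are its leftmost (rightmost) root children in the top
tier; what lies below the external edge becomes its external-edge children. The type of the parent
edge is provisional: it is set when the parent component is formed, and remains `external` for
the components at the root of the whole tree. -/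
def makePermanent (es : List Entry) : TopTree :=
  let lead := es.takeWhile fun e => !e.isActive
  let rest := es.dropWhile fun e => !e.isActive
  let trail := rest.rtakeWhile fun e => !e.isActive
  let a := passUp (rest.rdropWhile fun e => !e.isActive)
  .node .external a.shape (a.ext.map Prod.fst)
    (linkAll .newLeftmost .contLeftmost lead ++
      ((a.ext.map Prod.snd).getD []).map (TopTree.setEdge .external) ++
      linkAll .newRightmost .contRightmost trail)

/-- No further active component may join the component formed by `v` and `es`: it contains a child
of `v`, and it has reached size `B` or, at a branching node, is followed by a heavy child. -/
def isClosed (B : ℕ) (branching : Bool) (es : List Entry) : Bool :=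
  es.any Entry.isActive &&
    (decide (B ≤ (blockShape es).size) || (branching && es.getLast?.any fun e => !e.isActive))

/-- Greedy packing of the children of a node, left to right. Each resulting list `es` stands for one
component, made of `v` and the active components in `es`. A permanent child joins no component; it
is listed with the component to which it is attached in the top tier. -/
def pack (B : ℕ) (branching : Bool) (cur : List Entry) : List Entry → List (List Entry)
  | [] => [cur]
  | e :: es =>
    if isClosed B branching cur && e.isActive then cur :: pack B branching [e] es
    else pack B branching (cur ++ [e]) es

/-- The result of the decomposition procedure at `v`: either one component that is still active, or
the permanent components with root `v`. -/
inductive Outcome : Type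
  | active (es : List Entry) : Outcome
  | permanent (ts : List TopTree) : Outcome

/-- The components with root `v` after all of them have been declared permanent. -/
def Outcome.sealed : Outcome → List TopTree
  | .active es => [makePermanent es]
  | .permanent ts => ts

/-- The entry of a child. At a branching node, the components of heavy children are declared
permanent. -/
def toEntry (branching heavy : Bool) (o : Outcome) : Entry :=
  match o with
  | .permanent ts => .permanent ts
  | .active es => if branching && heavy then .permanent o.sealed else .active (passUp es)

/-- Form the components at a node `v`, given for each child whether it is heavy, and its outcome.
A branching node has at least two heavy children. The component of `v` stays active if it is the
only one, has fewer than `B` nodes and `v` is not branching. -/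
def combine (B : ℕ) (cs : List (Bool × Outcome)) : Outcome :=
  let branching : Bool := decide (2 ≤ cs.countP fun c => c.1)
  match pack B branching [] (cs.map fun c => toEntry branching c.1 c.2) with
  | [es] =>
    if !branching && decide ((blockShape es).size < B) then .active es
    else .permanent [makePermanent es]
  | bs => .permanent (bs.map makePermanent)

mutual
/-- The Farzan-Munro decomposition with parameter `B`. -/
def decompose (B : ℕ) : OrdinalTree → Outcome
  | .node ts => combine B (decomposeForest B ts)
/-- For each tree, whether its root is heavy (it has at least `B` nodes), and its outcome. -/
def decomposeForest (B : ℕ) : List OrdinalTree → List (Bool × Outcome)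
  | [] => []
  | t :: ts => (decide (B ≤ t.size), decompose B t) :: decomposeForest B ts
end

/-- The micro trees at the root of `t`, with the top tier below them. -/
def topTier (B : ℕ) (t : OrdinalTree) : List TopTree := (decompose B t).sealed

namespace TopTree

/-- Local shape of a micro tree. -/
def shape : TopTree → OrdinalTree
  | node _ s _ _ => s

/-- Type of the parent edge of a micro tree. -/
def edge : TopTree → EdgeType
  | node e _ _ _ => e

/-- Portal of a micro tree. -/
def portal : TopTree → Option (ℕ × ℕ)
  | node _ _ p _ => p

mutual
/-- The underlying ordinal tree. -/
def skeleton : TopTree → OrdinalTree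
  | node _ _ _ cs => .node (skeletons cs)
/-- The underlying ordinal forest. -/
def skeletons : List TopTree → List OrdinalTree
  | [] => []
  | T :: Ts => skeleton T :: skeletons Ts
end

mutual
/-- All micro trees of a top tier, in depth-first order. -/
def dfs : TopTree → List TopTree
  | node e s p cs => node e s p cs :: dfsForest cs
/-- All micro trees of a list of top tiers, in depth-first order. -/
def dfsForest : List TopTree → List TopTree
  | [] => []
  | T :: Ts => dfs T ++ dfsForest Ts
end

end TopTree

/-! ### The hypersuccinct code -/

/-- The parameter `B = ⌈(lg n) / 8⌉` of the decomposition. -/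
noncomputable def blockParam (n : ℕ) : ℕ := ⌈Real.logb 2 n / 8⌉₊

/-- The micro trees of `t` in depth-first order of the top tier. -/
noncomputable def microTrees (t : OrdinalTree) : List TopTree :=
  TopTree.dfsForest (topTier (blockParam t.size) t)

/-- The string of the local shapes of the micro trees of `t`. -/
noncomputable def microShapes (t : OrdinalTree) : List OrdinalTree :=
  (microTrees t).map TopTree.shape

/-- The top tier of `t` as an ordinal tree, with a dummy root. -/
noncomputable def topTierTree (t : OrdinalTree) : OrdinalTree :=
  .node (TopTree.skeletons (topTier (blockParam t.size) t))

/-- Three bits for an edge type. -/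
def EdgeType.bits : EdgeType → List Bool
  | newLeftmost => [false, false, false]
  | contLeftmost => [false, false, true]
  | newRightmost => [false, true, false]
  | contRightmost => [false, true, true]
  | external => [true, false, false]

/-- A table of the codewords of the given shapes: the number of entries, and for each shape `s` the
codeword (preceded by its length) and `s` itself (its size and its balanced-parenthesis sequence). -/
def codeTable (C : OrdinalTree → List Bool) (shapes : List OrdinalTree) : List Bool :=
  eliasGamma shapes.length ++ shapes.flatMap fun s =>
    eliasGamma (C s).length ++ C s ++ eliasGamma s.size ++ s.bp

/-- A portal as two integers of `w` bits; `(0, 0)` stands for a missing portal. -/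
def portalBits (w : ℕ) (p : Option (ℕ × ℕ)) : List Bool :=
  fixedWidth w (p.getD (0, 0)).1 ++ fixedWidth w (p.getD (0, 0)).2

/-- The hypersuccinct codeword of `t`, given a Huffman tree for its string of micro tree shapes.
Portals use `⌈lg (μ + 1)⌉` bits per integer, where `μ = 2 B` bounds the size of micro trees. -/
noncomputable def encodeWith (T : CodeTree OrdinalTree) (t : OrdinalTree) : List Bool :=
  let C := lengthRestrict T.code
  let w := Nat.clog 2 (2 * blockParam t.size + 1)
  eliasGamma t.size ++ eliasGamma (microTrees t).length ++
    (topTierTree t).bp ++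
    codeTable C (microShapes t).dedup ++
    (microShapes t).flatMap C ++
    (microTrees t).flatMap (fun M => portalBits w M.portal) ++
    (microTrees t).flatMap (fun M => M.edge.bits)

/-- `H` is the hypersuccinct code for ordinal trees, for some way of breaking ties in the
construction of the Huffman codes. -/
def IsHypersuccinctCode (H : OrdinalTree → List Bool) : Prop :=
  ∀ t, ∃ T, IsHuffmanTree (microShapes t) T ∧ H t = encodeWith T t

/-! ### Existence of the code -/

theorem exists_huffmanMerge {α : Type} (n : ℕ) :
    ∀ S : Multiset (CodeTree α), S.card = n + 1 → ∃ T, HuffmanMerge S T := by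
  induction n with
  | zero =>
    intro S hS
    obtain ⟨a, rfl⟩ := Multiset.card_eq_one.1 hS
    exact ⟨a, .single a⟩
  | succ n ih =>
    intro S hS
    have key : ∀ S : Multiset (CodeTree α), 0 < S.card →
        ∃ x S', S = x ::ₘ S' ∧ ∀ z ∈ S', x.weight ≤ z.weight := by
      classical
      intro S hS
      obtain ⟨a, ha⟩ := Multiset.card_pos_iff_exists_mem.1 hS
      obtain ⟨x, hx, hmin⟩ :=
        S.toFinset.exists_min_image CodeTree.weight ⟨a, Multiset.mem_toFinset.2 ha⟩
      refine ⟨x, S.erase x, (Multiset.cons_erase (Multiset.mem_toFinset.1 hx)).symm, ?_⟩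
      intro z hz
      exact hmin z (Multiset.mem_toFinset.2 (Multiset.mem_of_mem_erase hz))
    obtain ⟨x, S₁, rfl, hx⟩ := key S (by omega)
    rw [Multiset.card_cons] at hS
    obtain ⟨y, S₂, rfl, hy⟩ := key S₁ (by omega)
    rw [Multiset.card_cons] at hS
    obtain ⟨T, hT⟩ := ih (CodeTree.node x y ::ₘ S₂) (by rw [Multiset.card_cons]; omega)
    exact ⟨T, .merge x y S₂ T (hx y (Multiset.mem_cons_self y S₂)) hy hT⟩

theorem pack_ne_nil (B : ℕ) (br : Bool) (es : List Entry) :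
    ∀ cur, pack B br cur es ≠ [] := by
  induction es with
  | nil => intro cur; simp [pack]
  | cons e es ih =>
    intro cur
    rw [pack]
    split
    · simp
    · exact ih _

theorem topTier_ne_nil (B : ℕ) (t : OrdinalTree) : topTier B t ≠ [] := by
  obtain ⟨ts⟩ := t
  rw [topTier, decompose, combine]
  split
  · split <;> simp [Outcome.sealed]
  · simpa [Outcome.sealed] using pack_ne_nil _ _ _ _

theorem microShapes_ne_nil (t : OrdinalTree) : microShapes t ≠ [] := by
  rw [microShapes, microTrees]
  rcases h : topTier (blockParam t.size) t with _ | ⟨⟨e, s, p, cs⟩, Ts⟩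
  · exact absurd h (topTier_ne_nil _ _)
  · simp [TopTree.dfsForest, TopTree.dfs]

/-- Huffman trees exist for the micro tree shapes of every tree, so the code is defined. -/
theorem exists_isHypersuccinctCode : ∃ H, IsHypersuccinctCode H := by
  have h : ∀ t, ∃ T, IsHuffmanTree (microShapes t) T := by
    intro t
    have hpos : 0 < (microShapes t).dedup.length := by
      rw [List.length_pos_iff]
      simpa [List.dedup_eq_nil] using microShapes_ne_nil t
    refine exists_huffmanMerge ((microShapes t).dedup.length - 1) _ ?_
    rw [Multiset.coe_card, List.length_map]
    omega
  choose T hT using h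
  exact ⟨fun t => encodeWith (T t) t, fun t => ⟨T t, hT t, rfl⟩⟩

end Hypersuccinct

-- A Huffman code is, in total, no longer than any assignment of codeword lengths that satisfies
-- Kraft's inequality. So it suffices to exhibit one such assignment on the micro tree shapes whose
-- total is the shape entropy plus lower-order terms. This competitor may depend on the whole tree
-- `t`, since it is never written down.
--
-- Apart from its root, a micro tree is a piece of `fcns [t]`: it may halt within a run of siblings,
-- and it may skip a child that belongs to other components. An `Annotation` records the piece
-- together with these two kinds of cuts. It is coded node by node with the empirical probabilities
-- of leaf and inner node given the `k`-history in `fcns [t]`, mixed with the uniform distribution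
-- on the four events leaf, inner, halt, skip. A mixing weight of `1/(2B)` costs at most `1/B` bit
-- per node and makes every cut cost `lg (8B)` bits. Another `k` bits state the history in which the
-- piece starts. A shape gets the length of its cheapest description (`CostModel.length`); Kraft's
-- inequality holds because the probabilities of the four events add up to at most one
-- (`CostModel.sum_length_le_one`).
--
-- Every node of `fcns [t]` is paid for at most once, so the total is at most the entropy plus
-- `O(n/B)` for the mixing plus `K * N`. Here `N` accounts for cuts and micro trees, and `K` covers
-- the starting history, a cut, and all fixed costs of a micro tree (portal, edge type, its share of
-- the top tier). An amortised count through the Farzan-Munro procedure gives `B * N ≤ 18 n + B`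
-- (`OutcomesFit.combine`, `weightSum_topTier_le`). With `B` about `(lg n) / 8` this is `O(n (k +
-- log log n) / log n)`. Since micro trees have at most `2B` nodes, there are at most `2 ^ (4B)`
-- shapes, and the code table takes only `O(√n log n)` bits.

namespace Hypersuccinct

/-! ### Optimality of Huffman codes -/

namespace CodeTree

variable {α : Type}

/-- Total frequency of the symbols, weighted by the lengths of their codewords. -/
def cost : CodeTree α → ℕ
  | leaf _ _ => 0
  | node l r => l.cost + r.cost + (l.weight + r.weight)

/-- The frequencies stored in the leaves are given by `F`. -/
def HasFreq (F : α → ℕ) : CodeTree α → Prop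
  | leaf a f => f = F a
  | node l r => l.HasFreq F ∧ r.HasFreq F

/-- The symbols of a code tree. -/
def symbols (T : CodeTree α) : Multiset α := (T.codewords.map Prod.fst : List α)

@[simp] theorem symbols_leaf (a : α) (f : ℕ) : (leaf a f).symbols = {a} := rfl

@[simp] theorem symbols_node (l r : CodeTree α) :
    (node l r).symbols = l.symbols + r.symbols := by
  simp [symbols, codewords, Function.comp_def]

theorem sum_freq_codewords {F : α → ℕ} {T : CodeTree α} (h : T.HasFreq F) :
    (T.codewords.map fun p => F p.1).sum = T.weight := by
  induction T with
  | leaf a f => simpa [codewords, weight, HasFreq] using h.symm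
  | node l r ihl ihr =>
    simp [codewords, weight, Function.comp_def, ihl h.1, ihr h.2]

/-- A codeword is as long as its leaf has proper ancestors, so summing frequency times length over
leaves is the same as summing weights over inner nodes, which is what `cost` does. -/
theorem sum_freq_mul_length_codewords {F : α → ℕ} {T : CodeTree α} (h : T.HasFreq F) :
    (T.codewords.map fun p => F p.1 * p.2.length).sum = T.cost := by
  induction T with
  | leaf a f => simp [codewords, cost]
  | node l r ihl ihr =>
    have hl := sum_freq_codewords h.1
    have hr := sum_freq_codewords h.2
    simp only [codewords, List.map_append, List.map_map, Function.comp_def, List.length_cons,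
      mul_add, mul_one, List.sum_append, List.sum_map_add, ihl h.1, ihr h.2, hl, hr, cost]
    ring

end CodeTree

variable {α : Type}

theorem HuffmanMerge.hasFreq {F : α → ℕ} {S : Multiset (CodeTree α)} {T : CodeTree α}
    (h : HuffmanMerge S T) (hS : ∀ x ∈ S, x.HasFreq F) : T.HasFreq F := by
  induction h with
  | single T => exact hS T (by simp)
  | merge x y S T _ _ _ ih =>
    refine ih fun z hz => ?_
    rcases Multiset.mem_cons.1 hz with rfl | hz
    · exact ⟨hS x (by simp), hS y (by simp)⟩
    · exact hS z (by simp [hz])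

theorem HuffmanMerge.symbols_eq {S : Multiset (CodeTree α)} {T : CodeTree α}
    (h : HuffmanMerge S T) : T.symbols = (S.map CodeTree.symbols).sum := by
  induction h with
  | single T => simp
  | merge x y S T _ _ _ ih => simp [ih, add_assoc]

/-- A symbol of least weight may be assumed to have a longest codeword. -/
theorem exists_longest_of_least {P : Multiset (CodeTree α × ℕ)} {x : CodeTree α}
    {S : Multiset (CodeTree α)} (hP : P.map Prod.fst = x ::ₘ S)
    (hx : ∀ z ∈ S, x.weight ≤ z.weight) :
    ∃ (c : ℕ) (R : Multiset (CodeTree α × ℕ)), R.map Prod.fst = S ∧ (∀ p ∈ R, p.2 ≤ c) ∧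
      c ::ₘ R.map Prod.snd = P.map Prod.snd ∧
      x.cost + x.weight * c + (R.map fun p => p.1.cost + p.1.weight * p.2).sum ≤
        (P.map fun p => p.1.cost + p.1.weight * p.2).sum := by
  classical
  obtain ⟨⟨x', a⟩, hmem, hxx, hQ⟩ := (Multiset.map_eq_cons _ _ _ _).2 hP
  obtain rfl : x' = x := hxx
  obtain ⟨Q, rfl⟩ := Multiset.exists_cons_of_mem hmem
  rw [Multiset.erase_cons_head] at hQ
  by_cases hmax : ∀ p ∈ Q, p.2 ≤ a
  · exact ⟨a, Q, hQ, hmax, by simp, by simp⟩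
  -- Exchange argument: swap the length of `x'` with a longest one. As `x'` has least weight, the
  -- total does not grow, and the multiset of lengths, hence the Kraft sum, is unchanged.
  · push Not at hmax
    obtain ⟨p, hp, hpa⟩ := hmax
    obtain ⟨⟨z, c⟩, hzc, hm⟩ :=
      Q.toFinset.exists_max_image Prod.snd ⟨p, Multiset.mem_toFinset.2 hp⟩
    rw [Multiset.mem_toFinset] at hzc
    have hac : a < c := lt_of_lt_of_le hpa (hm p (Multiset.mem_toFinset.2 hp))
    have hxz : x'.weight ≤ z.weight := by
      apply hx
      rw [← hQ]
      exact Multiset.mem_map_of_mem Prod.fst hzc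
    obtain ⟨R, rfl⟩ := Multiset.exists_cons_of_mem hzc
    refine ⟨c, (z, a) ::ₘ R, by simpa using hQ, ?_, ?_, ?_⟩
    · intro p hp
      rcases Multiset.mem_cons.1 hp with rfl | hp
      · exact hac.le
      · exact hm p (by simp [hp])
    · simp [Multiset.cons_swap]
    · simp only [Multiset.map_cons, Multiset.sum_cons]
      nlinarith

/-- Integrality: all lengths in `R` are at most `d`, so scaling by `2 ^ d` makes their sum a natural
number `N`. From `N + 1 < 2 ^ d` follows `N + 2 ≤ 2 ^ d`, so the longest length `c` can be lowered
to `d` for free. Two words of length `d` then merge into one of length `d - 1`. -/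
theorem kraft_merge {R : Multiset ℕ} {c d : ℕ} (hdc : d ≤ c) (hR : ∀ l ∈ R, l ≤ d)
    (h : (2⁻¹ : ℝ) ^ c + ((2⁻¹ : ℝ) ^ d + (R.map fun l => (2⁻¹ : ℝ) ^ l).sum) ≤ 1) :
    1 ≤ d ∧ (2⁻¹ : ℝ) ^ (d - 1) + (R.map fun l => (2⁻¹ : ℝ) ^ l).sum ≤ 1 := by
  have hsum : (2 : ℝ) ^ d * (R.map fun l => (2⁻¹ : ℝ) ^ l).sum
      = ((R.map fun l => 2 ^ (d - l)).sum : ℕ) := by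
    rw [← Multiset.sum_map_mul_left, Nat.cast_multiset_sum, Multiset.map_map]
    refine congrArg Multiset.sum (Multiset.map_congr rfl fun l hl => ?_)
    have := hR l hl
    simp only [Function.comp_apply, Nat.cast_pow, Nat.cast_ofNat, inv_pow]
    rw [pow_sub₀ _ two_ne_zero this]
  have hd : (2 : ℝ) ^ d * (2⁻¹ : ℝ) ^ d = 1 := by rw [← mul_pow]; norm_num
  have hpos : (0 : ℝ) < 2 ^ d := by positivity
  have hc : (0 : ℝ) < 2 ^ d * (2⁻¹ : ℝ) ^ c := by positivity
  generalize (R.map fun l => 2 ^ (d - l)).sum = N at hsum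
  have h2 : (N : ℝ) + 2 ≤ 2 ^ d := by
    have := mul_le_mul_of_nonneg_left h hpos.le
    rw [mul_add, mul_add, hd, hsum] at this
    have h3 : ((N + 1 : ℕ) : ℝ) < ((2 ^ d : ℕ) : ℝ) := by
      push_cast
      linarith
    have h4 : N + 2 ≤ 2 ^ d := Nat.cast_lt.1 h3
    exact_mod_cast h4
  have hd1 : 1 ≤ d := by
    by_contra hd0
    obtain rfl : d = 0 := by omega
    have : (0 : ℝ) ≤ N := Nat.cast_nonneg _
    norm_num at h2
    linarith
  refine ⟨hd1, ?_⟩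
  have hd' : (2 : ℝ) ^ d * (2⁻¹ : ℝ) ^ (d - 1) = 2 := by
    obtain ⟨e, rfl⟩ := Nat.exists_eq_add_of_le' hd1
    rw [Nat.add_sub_cancel, pow_succ, mul_right_comm, ← mul_pow]
    norm_num
  refine le_of_mul_le_mul_left ?_ hpos
  rw [mul_add, hd', hsum]
  linarith

/-- Huffman trees have least cost among all assignments of lengths with Kraft's inequality. -/
theorem HuffmanMerge.cost_le {S : Multiset (CodeTree α)} {T : CodeTree α}
    (h : HuffmanMerge S T) : ∀ P : Multiset (CodeTree α × ℕ), P.map Prod.fst = S →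
      ((P.map Prod.snd).map fun l => (2⁻¹ : ℝ) ^ l).sum ≤ 1 →
      T.cost ≤ (P.map fun p => p.1.cost + p.1.weight * p.2).sum := by
  induction h with
  | single T =>
    intro P hP _
    obtain ⟨p, rfl, rfl⟩ := Multiset.map_eq_singleton.1 hP
    simp
  | merge x y S T hxy hy _ ih =>
    intro P hP hK
    obtain ⟨c, R, hR, hRc, hsnd, hcost⟩ := exists_longest_of_least hP (by
      intro z hz
      rcases Multiset.mem_cons.1 hz with rfl | hz
      · exact hxy
      · exact hxy.trans (hy z hz))
    obtain ⟨d, Q, hQ, hQd, hsnd', hcost'⟩ := exists_longest_of_least hR hy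
    have hdc : d ≤ c := by
      have : d ∈ R.map Prod.snd := by rw [← hsnd']; simp
      obtain ⟨p, hp, rfl⟩ := Multiset.mem_map.1 this
      exact hRc p hp
    rw [← hsnd, ← hsnd', Multiset.map_cons, Multiset.map_cons, Multiset.sum_cons,
      Multiset.sum_cons] at hK
    obtain ⟨hd, hK'⟩ := kraft_merge hdc (by
      intro l hl
      obtain ⟨p, hp, rfl⟩ := Multiset.mem_map.1 hl
      exact hQd p hp) hK
    -- The merged tree is placed at depth `d - 1`; the summand `x.weight + y.weight` of its own cost
    -- puts both children back at depth `d ≤ c`.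
    have := ih ((CodeTree.node x y, d - 1) ::ₘ Q) (by simp [hQ]) (by simpa using hK')
    refine this.trans ((?_ : _ ≤ _).trans hcost)
    simp only [Multiset.map_cons, Multiset.sum_cons, CodeTree.cost, CodeTree.weight]
    obtain ⟨e, rfl⟩ := Nat.exists_eq_add_of_le' hd
    have : x.weight * (e + 1) ≤ x.weight * c := Nat.mul_le_mul_left _ hdc
    rw [Nat.add_sub_cancel]
    nlinarith

theorem lookup_eq_of_mem_of_nodup [DecidableEq α] {β : Type} {l : List (α × β)}
    (hl : (l.map Prod.fst).Nodup) {p : α × β} (hp : p ∈ l) : l.lookup p.1 = some p.2 := by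
  induction l with
  | nil => simp at hp
  | cons q l ih =>
    rw [List.map_cons, List.nodup_cons] at hl
    obtain ⟨q1, q2⟩ := q
    rcases List.mem_cons.1 hp with rfl | hp
    · simp
    · have hne : p.1 ≠ q1 := fun h => hl.1 (List.mem_map.2 ⟨p, hp, h⟩)
      have : (p.1 == q1) = false := by simpa using hne
      simp [List.lookup, this, ih hl.2 hp]

/-- Total length of the codewords of a string under its Huffman code, compared with any lengths
that satisfy Kraft's inequality. -/
theorem IsHuffmanTree.sum_length_code_le [DecidableEq α] {s : List α} {T : CodeTree α}
    (h : IsHuffmanTree s T) (l : α → ℕ) (hl : ∑ a ∈ s.toFinset, (2⁻¹ : ℝ) ^ l a ≤ 1) :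
    (s.map fun a => (T.code a).length).sum ≤ (s.map l).sum := by
  have hfreq : T.HasFreq fun a => s.count a := by
    refine h.hasFreq fun x hx => ?_
    obtain ⟨a, _, rfl⟩ := List.mem_map.1 (Multiset.mem_coe.1 hx)
    rfl
  have hsym : T.symbols = (s.dedup : Multiset α) := by
    rw [h.symbols_eq]
    simp only [Multiset.map_coe, List.map_map, Multiset.sum_coe, Function.comp_def,
      CodeTree.symbols_leaf]
    rw [← Multiset.sum_coe, ← Multiset.map_coe, Multiset.sum_map_singleton]
  have hnodup : (T.codewords.map Prod.fst).Nodup := by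
    rw [← Multiset.coe_nodup]
    change T.symbols.Nodup
    rw [hsym]
    exact Multiset.coe_nodup.2 s.nodup_dedup
  have hfin : ∀ g : α → ℕ, ∑ a ∈ s.toFinset, g a = (T.codewords.map fun p => g p.1).sum := by
    intro g
    have : ((T.symbols).map g).sum = (T.codewords.map fun p => g p.1).sum := by
      simp [CodeTree.symbols, Function.comp_def]
    rw [← this, hsym, ← List.toFinset_val]
    rfl
  have h1 : (s.map fun a => (T.code a).length).sum = T.cost := by
    rw [Finset.sum_list_map_count, hfin, ← CodeTree.sum_freq_mul_length_codewords hfreq]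
    refine congrArg List.sum (List.map_congr_left fun p hp => ?_)
    rw [CodeTree.code, lookup_eq_of_mem_of_nodup hnodup hp]
    simp
  have h2 := h.cost_le ((s.dedup.map fun a => (CodeTree.leaf a (s.count a), l a) :
      List (CodeTree α × ℕ)) : Multiset (CodeTree α × ℕ)) (by simp [Function.comp_def]) (by
    refine le_trans (le_of_eq ?_) hl
    rw [Finset.sum, List.toFinset_val]
    simp [Function.comp_def])
  rw [h1]
  refine h2.trans (le_of_eq ?_)
  rw [Finset.sum_list_map_count, Finset.sum, List.toFinset_val]
  simp [Function.comp_def, CodeTree.cost, CodeTree.weight]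

end Hypersuccinct
namespace Hypersuccinct

/-! ### Annotated forests -/

/-- Induction on ordinal forests along the first-child next-sibling encoding. -/
theorem forest_induction {P : List OrdinalTree → Prop} (nil : P [])
    (cons : ∀ f g, P f → P g → P (.node f :: g)) (f : List OrdinalTree) : P f := by
  have h : ∀ n, ∀ f, OrdinalTree.sizeForest f ≤ n → P f := by
    intro n
    induction n with
    | zero =>
      rintro (_ | ⟨⟨f⟩, g⟩) hf
      · exact nil
      · simp [OrdinalTree.sizeForest, OrdinalTree.size] at hf
    | succ n ih =>
      rintro (_ | ⟨⟨f⟩, g⟩) hf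
      · exact nil
      · simp only [OrdinalTree.sizeForest, OrdinalTree.size] at hf
        exact cons f g (ih f (by omega)) (ih g (by omega))
  exact h _ f le_rfl

/-- A part of the first-child next-sibling encoding of a forest: the part may end at any node, and
it may skip a tree of the forest and continue with the next sibling. -/
inductive Annotation : Type
  | leaf : Annotation
  | halt : Annotation
  | node (l r : Annotation) : Annotation
  | skip (r : Annotation) : Annotation

/-- Costs of the nodes of a first-child next-sibling encoding, in terms of their shape history, and
of stopping and skipping. -/
structure CostModel : Type where
  leaf : List Bool → ℝ
  inner : List Bool → ℝ
  cut : ℝ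

namespace Annotation

noncomputable instance : DecidableEq Annotation := Classical.decEq _

/-- The forest that is made of the nodes of an annotated forest. -/
def erase : Annotation → List OrdinalTree
  | leaf => []
  | halt => []
  | node l r => .node l.erase :: r.erase
  | skip r => r.erase

/-- The cost of an annotated forest whose first node has history `h`. -/
def cost (φ : CostModel) (h : List Bool) : Annotation → ℝ
  | leaf => φ.leaf h
  | halt => φ.cut
  | node l r => φ.inner h + l.cost φ (h ++ [false]) + r.cost φ (h ++ [true])
  | skip r => φ.cut + r.cost φ (h ++ [true])

/-- The height of an annotation. -/
def height : Annotation → ℕ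
  | leaf => 1
  | halt => 1
  | node l r => max l.height r.height + 1
  | skip r => r.height + 1

/-- A finite set that contains all annotations of height at most `d`. -/
noncomputable def upTo : ℕ → Finset Annotation
  | 0 => ∅
  | d + 1 => insert leaf (insert halt
      ((upTo d ×ˢ upTo d).image (fun p => node p.1 p.2) ∪ (upTo d).image skip))

theorem mem_upTo {A : Annotation} : ∀ {d : ℕ}, A.height ≤ d → A ∈ upTo d := by
  induction A with
  | leaf =>
    rintro (_ | d) h
    · simp [height] at h
    · simp [upTo]
  | halt =>
    rintro (_ | d) h
    · simp [height] at h
    · simp [upTo]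
  | node l r ihl ihr =>
    rintro (_ | d) h
    · simp [height] at h
    · simp only [height, Nat.add_le_add_iff_right, sup_le_iff] at h
      simp [upTo, ihl h.1, ihr h.2]
  | skip r ih =>
    rintro (_ | d) h
    · simp [height] at h
    · simp only [height, Nat.add_le_add_iff_right] at h
      simp [upTo, ih h]

end Annotation

/-- The codeword lengths given by the costs satisfy Kraft's inequality at every node. -/
def CostModel.Kraft (φ : CostModel) : Prop :=
  ∀ h, (2 : ℝ) ^ (-φ.leaf h) + 2 ^ (-φ.inner h) + 2 * 2 ^ (-φ.cut) ≤ 1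

namespace Annotation

/-- By induction on the height: the sum over `node l r` factors into the sums for the two subtrees,
each at most one, and likewise for `skip`. What remains is the local inequality `CostModel.Kraft`,
whose two cut terms belong to `halt` and `skip`. Restricting the height keeps all sums finite. -/
theorem sum_upTo_le {φ : CostModel} (hφ : φ.Kraft) (d : ℕ) :
    ∀ h, ∑ A ∈ upTo d, (2 : ℝ) ^ (-A.cost φ h) ≤ 1 := by
  induction d with
  | zero => simp [upTo]
  | succ d ih =>
    intro h
    have hnode : ∑ A ∈ (upTo d ×ˢ upTo d).image (fun p => node p.1 p.2), (2 : ℝ) ^ (-A.cost φ h)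
        ≤ 2 ^ (-φ.inner h) := by
      rw [Finset.sum_image (by rintro ⟨a, b⟩ _ ⟨c, d⟩ _ h; simpa using h), Finset.sum_product]
      have : ∀ l r : Annotation, (2 : ℝ) ^ (-(node l r).cost φ h) = 2 ^ (-φ.inner h) *
          (2 ^ (-l.cost φ (h ++ [false])) * 2 ^ (-r.cost φ (h ++ [true]))) := by
        intro l r
        rw [← Real.rpow_add two_pos, ← Real.rpow_add two_pos, cost]
        congr 1
        ring
      simp only [this, ← Finset.mul_sum, ← Finset.sum_mul]
      refine mul_le_of_le_one_right (by positivity)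
        (mul_le_one₀ (ih _) (Finset.sum_nonneg fun _ _ => by positivity) (ih _))
    have hskip : ∑ A ∈ (upTo d).image skip, (2 : ℝ) ^ (-A.cost φ h) ≤ 2 ^ (-φ.cut) := by
      rw [Finset.sum_image (by intro a _ b _ h; simpa using h)]
      have : ∀ r : Annotation, (2 : ℝ) ^ (-(skip r).cost φ h) = 2 ^ (-φ.cut) *
          2 ^ (-r.cost φ (h ++ [true])) := by
        intro r
        rw [← Real.rpow_add two_pos, cost]
        congr 1
        ring
      simp only [this, ← Finset.mul_sum]
      exact mul_le_of_le_one_right (by positivity) (ih _)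
    have hu : ∑ A ∈ (upTo d ×ˢ upTo d).image (fun p => node p.1 p.2) ∪ (upTo d).image skip,
        (2 : ℝ) ^ (-A.cost φ h) ≤ 2 ^ (-φ.inner h) + 2 ^ (-φ.cut) := by
      refine le_trans ?_ (add_le_add hnode hskip)
      rw [← Finset.sum_union_inter]
      exact le_add_of_nonneg_right (Finset.sum_nonneg fun _ _ => by positivity)
    rw [upTo, Finset.sum_insert (by simp), Finset.sum_insert (by simp)]
    have := hφ h
    simp only [cost]
    linarith

theorem sum_le_one {φ : CostModel} (hφ : φ.Kraft) (h : List Bool) (S : Finset Annotation) :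
    ∑ A ∈ S, (2 : ℝ) ^ (-A.cost φ h) ≤ 1 := by
  refine le_trans (Finset.sum_le_sum_of_subset_of_nonneg (t := upTo (S.sup height)) ?_
    fun _ _ _ => by positivity) (sum_upTo_le hφ _ h)
  intro A hA
  exact mem_upTo (Finset.le_sup hA)

theorem exists_erase_eq (f : List OrdinalTree) : ∃ A : Annotation, A.erase = f := by
  induction f using forest_induction with
  | nil => exact ⟨leaf, rfl⟩
  | cons f g hf hg =>
    obtain ⟨A, rfl⟩ := hf
    obtain ⟨A', rfl⟩ := hg
    exact ⟨node A A', rfl⟩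

end Annotation

/-! ### Histories -/

theorem length_kHistory (k : ℕ) (h : List Bool) : (kHistory k h).length = k := by
  simp [kHistory]

theorem kHistory_append_singleton (k : ℕ) (h : List Bool) (b : Bool) :
    kHistory k (h ++ [b]) = (kHistory k h ++ [b]).drop 1 := by
  rw [kHistory, kHistory, ← List.drop_append_of_le_length (by simp), List.drop_drop,
    List.append_assoc, List.length_append, List.length_singleton]

theorem kHistory_kHistory (k : ℕ) (h : List Bool) : kHistory k (kHistory k h) = kHistory k h := by
  rw [kHistory, length_kHistory, List.drop_append_of_le_length (by simp)]
  simp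

/-- The costs depend only on the `k`-th order history. -/
def CostModel.HasOrder (φ : CostModel) (k : ℕ) : Prop :=
  ∀ h, φ.leaf (kHistory k h) = φ.leaf h ∧ φ.inner (kHistory k h) = φ.inner h

/-- The history is a sliding window: the `k`-history of a child is determined by that of its parent
and the direction. Hence `k` bits of context at the first node determine all later costs. -/
theorem Annotation.cost_congr {φ : CostModel} {k : ℕ} (hφ : φ.HasOrder k) (A : Annotation) :
    ∀ h h', kHistory k h = kHistory k h' → A.cost φ h = A.cost φ h' := by
  have hstep : ∀ {h h'} (b : Bool), kHistory k h = kHistory k h' →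
      kHistory k (h ++ [b]) = kHistory k (h' ++ [b]) := by
    intro h h' b hh
    rw [kHistory_append_singleton, kHistory_append_singleton, hh]
  induction A with
  | leaf =>
    intro h h' hh
    rw [cost, cost, ← (hφ h).1, ← (hφ h').1, hh]
  | halt => intros; rfl
  | node l r ihl ihr =>
    intro h h' hh
    rw [cost, cost, ← (hφ h).2, ← (hφ h').2, hh, ihl _ _ (hstep _ hh), ihr _ _ (hstep _ hh)]
  | skip r ih =>
    intro h h' hh
    rw [cost, cost, ih _ _ (hstep _ hh)]

/-! ### Codeword lengths for the shapes of micro trees -/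

/-- `n` bits suffice to describe `s` by a history of length `k` and an annotated forest. -/
def CostModel.Describes (φ : CostModel) (k : ℕ) (s : OrdinalTree) (n : ℕ) : Prop :=
  ∃ (h : List Bool) (A : Annotation), s = .node A.erase ∧ k + A.cost φ h ≤ n

theorem CostModel.exists_describes (φ : CostModel) (k : ℕ) (s : OrdinalTree) :
    ∃ n, φ.Describes k s n := by
  obtain ⟨f⟩ := s
  obtain ⟨A, rfl⟩ := Annotation.exists_erase_eq f
  obtain ⟨n, hn⟩ := exists_nat_ge (k + A.cost φ [])
  exact ⟨n, [], A, rfl, hn⟩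

open Classical in
/-- The least number of bits that suffice to describe a shape. -/
noncomputable def CostModel.length (φ : CostModel) (k : ℕ) (s : OrdinalTree) : ℕ :=
  Nat.find (φ.exists_describes k s)

/-- Minimality over all descriptions makes this hold for whichever history and annotation an
occurrence of the shape really has; the final `1` pays for rounding up. -/
theorem CostModel.length_le (φ : CostModel) (k : ℕ) (h : List Bool) (A : Annotation)
    (hA : 0 ≤ A.cost φ h) : (φ.length k (.node A.erase) : ℝ) ≤ k + A.cost φ h + 1 := by
  classical
  have : φ.length k (.node A.erase) ≤ ⌈k + A.cost φ h⌉₊ :=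
    Nat.find_min' _ ⟨h, A, rfl, Nat.le_ceil _⟩
  refine le_trans (Nat.cast_le.2 this) (Nat.ceil_lt_add_one (by positivity)).le

/-- A `k`-history together with an annotation determines the shape, so distinct shapes use distinct
pairs. There are at most `2 ^ k` histories, each carrying the factor `2 ^ (-k)`, and for each of
them the annotations sum to at most one. -/
theorem CostModel.sum_length_le_one {φ : CostModel} (hφ : φ.Kraft) {k : ℕ} (hk : φ.HasOrder k)
    (S : Finset OrdinalTree) : ∑ s ∈ S, (2⁻¹ : ℝ) ^ φ.length k s ≤ 1 := by
  classical
  have hex : ∀ s, φ.Describes k s (φ.length k s) := fun s => Nat.find_spec (φ.exists_describes k s)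
  choose h A hA hle using hex
  let Z : Finset (List Bool) := (Finset.univ : Finset (Fin k → Bool)).image List.ofFn
  have hZ : (Z.card : ℝ) ≤ 2 ^ k := by
    have : Z.card ≤ 2 ^ k := Finset.card_image_le.trans (by simp)
    exact_mod_cast this
  have hmem : ∀ s, kHistory k (h s) ∈ Z := by
    intro s
    refine Finset.mem_image.2 ⟨fun i => (kHistory k (h s))[i]'(by
      rw [length_kHistory]; exact i.2), Finset.mem_univ _, ?_⟩
    apply List.ext_getElem
    · simp [length_kHistory]
    · intro i _ _
      simp
  have hinj : Set.InjOn (fun s => (kHistory k (h s), A s)) S := by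
    intro s _ s' _ hss
    rw [hA s, hA s', show A s = A s' from (Prod.ext_iff.1 hss).2]
  calc ∑ s ∈ S, (2⁻¹ : ℝ) ^ φ.length k s
      ≤ ∑ s ∈ S, (2 : ℝ) ^ (-(k : ℝ)) * 2 ^ (-(A s).cost φ (kHistory k (h s))) := by
        refine Finset.sum_le_sum fun s _ => ?_
        rw [← Real.rpow_add two_pos, inv_pow, ← Real.rpow_natCast, ← Real.rpow_neg two_pos.le,
          (A s).cost_congr hk _ _ (kHistory_kHistory k (h s))]
        exact Real.rpow_le_rpow_of_exponent_le one_le_two (by linarith [hle s])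
    _ = ∑ p ∈ S.image (fun s => (kHistory k (h s), A s)),
          (2 : ℝ) ^ (-(k : ℝ)) * 2 ^ (-p.2.cost φ p.1) := by
        rw [Finset.sum_image hinj]
    _ ≤ ∑ p ∈ Z ×ˢ S.image A, (2 : ℝ) ^ (-(k : ℝ)) * 2 ^ (-p.2.cost φ p.1) := by
        refine Finset.sum_le_sum_of_subset_of_nonneg ?_ fun _ _ _ => by positivity
        intro p hp
        obtain ⟨s, hs, rfl⟩ := Finset.mem_image.1 hp
        exact Finset.mem_product.2 ⟨hmem s, Finset.mem_image_of_mem A hs⟩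
    _ = ∑ z ∈ Z, (2 : ℝ) ^ (-(k : ℝ)) * ∑ B ∈ S.image A, 2 ^ (-B.cost φ z) := by
        rw [Finset.sum_product]
        simp only [Finset.mul_sum]
    _ ≤ ∑ z ∈ Z, (2 : ℝ) ^ (-(k : ℝ)) := by
        refine Finset.sum_le_sum fun z _ => ?_
        exact mul_le_of_le_one_right (by positivity) (Annotation.sum_le_one hφ z _)
    _ ≤ 1 := by
        rw [Finset.sum_const, nsmul_eq_mul, Real.rpow_neg two_pos.le, Real.rpow_natCast]
        exact (mul_inv_le_iff₀ (by positivity)).2 (by simpa using hZ)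

end Hypersuccinct
namespace Hypersuccinct

/-! ### The shapes of the components -/

theorem TopTree.dfsForest_append (Ts Us : List TopTree) :
    dfsForest (Ts ++ Us) = dfsForest Ts ++ dfsForest Us := by
  induction Ts with
  | nil => simp [dfsForest]
  | cons T Ts ih => simp [dfsForest, ih]

/-- The shapes of all micro trees in a list of top tiers. -/
def shapes (Ts : List TopTree) : Multiset OrdinalTree :=
  ((TopTree.dfsForest Ts).map TopTree.shape : List OrdinalTree)

@[simp] theorem shapes_nil : shapes [] = 0 := rfl

@[simp] theorem shapes_append (Ts Us : List TopTree) :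
    shapes (Ts ++ Us) = shapes Ts + shapes Us := by
  simp [shapes, TopTree.dfsForest_append]

theorem shapes_cons (T : TopTree) (Ts : List TopTree) :
    shapes (T :: Ts) = shapes [T] + shapes Ts := shapes_append [T] Ts

theorem shapes_node (e : EdgeType) (s : OrdinalTree) (p : Option (ℕ × ℕ)) (cs : List TopTree) :
    shapes [.node e s p cs] = s ::ₘ shapes cs := by
  simp [shapes, TopTree.dfsForest, TopTree.dfs, TopTree.shape]

theorem shapes_setEdge (e : EdgeType) (T : TopTree) : shapes [T.setEdge e] = shapes [T] := by
  obtain ⟨e', s, p, cs⟩ := T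
  rw [TopTree.setEdge, shapes_node, shapes_node]

theorem shapes_map_setEdge (e : EdgeType) (Ts : List TopTree) :
    shapes (Ts.map (TopTree.setEdge e)) = shapes Ts := by
  induction Ts with
  | nil => rfl
  | cons T Ts ih => rw [List.map_cons, shapes_cons, ih, shapes_setEdge, ← shapes_cons]

theorem shapes_link (new cont : EdgeType) (Ts : List TopTree) :
    shapes (link new cont Ts) = shapes Ts := by
  cases Ts with
  | nil => rfl
  | cons T Ts => rw [link, shapes_cons, shapes_map_setEdge, shapes_setEdge, ← shapes_cons]

/-- The components to which the external edge leads. -/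
def extTrees (x : Option ((ℕ × ℕ) × List TopTree)) : List TopTree := (x.map Prod.snd).getD []

/-- The shapes of all permanent components below a child. -/
def Entry.shapesBelow : Entry → Multiset OrdinalTree
  | .active a => shapes (extTrees a.ext)
  | .permanent ts => shapes ts

theorem shapes_linkAll_le (new cont : EdgeType) (es : List Entry) :
    shapes (linkAll new cont es) ≤ (es.map Entry.shapesBelow).sum := by
  induction es with
  | nil => rfl
  | cons e es ih =>
    rw [linkAll, List.flatMap_cons, shapes_append, List.map_cons, List.sum_cons]
    refine add_le_add ?_ ih
    cases e with
    | active a => exact zero_le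
    | permanent ts => exact (shapes_link new cont ts).le

/-- Only an inequality, because `blockExt` follows the first external edge that it meets. Since
weights of shapes are nonnegative and only upper bounds are wanted, it need not be shown that
nothing is lost. -/
theorem shapes_blockExt_le (es : List Entry) : ∀ rank child,
    shapes (extTrees (blockExt rank child es)) ≤ (es.map Entry.shapesBelow).sum := by
  induction es with
  | nil => intros; rfl
  | cons e es ih =>
    intro rank child
    rw [List.map_cons, List.sum_cons]
    cases e with
    | permanent ts => exact Multiset.le_add_right _ _
    | active a =>
      obtain ⟨s, _ | ⟨⟨r, c⟩, ts⟩⟩ := a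
      · exact (ih _ _).trans (Multiset.le_add_left _ _)
      · exact Multiset.le_add_right _ _

theorem filterMap_shape_of_not_active {es : List Entry} (h : ∀ e ∈ es, (!e.isActive) = true) :
    es.filterMap Entry.shape? = [] := by
  rw [List.filterMap_eq_nil_iff]
  intro e he
  cases e with
  | active a => simpa [Entry.isActive] using h _ he
  | permanent ts => rfl

theorem shapes_makePermanent_le (es : List Entry) :
    shapes [makePermanent es] ≤ blockShape es ::ₘ (es.map Entry.shapesBelow).sum := by
  obtain ⟨lead, mid, trail, rfl, hlead, htrail, hmk⟩ : ∃ lead mid trail : List Entry,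
      es = lead ++ (mid ++ trail) ∧ (∀ e ∈ lead, (!e.isActive) = true) ∧
      (∀ e ∈ trail, (!e.isActive) = true) ∧
      makePermanent es = .node .external (passUp mid).shape ((passUp mid).ext.map Prod.fst)
        (linkAll .newLeftmost .contLeftmost lead ++
          (extTrees (passUp mid).ext).map (TopTree.setEdge .external) ++
          linkAll .newRightmost .contRightmost trail) := by
    refine ⟨_, _, _, ?_, ?_, ?_, rfl⟩
    · rw [List.rdropWhile, List.rtakeWhile, ← List.reverse_append, List.takeWhile_append_dropWhile,
        List.reverse_reverse, List.takeWhile_append_dropWhile]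
    · intro e he
      exact List.mem_takeWhile_imp (p := fun e : Entry => !e.isActive) he
    · intro e he
      exact List.mem_rtakeWhile_imp (p := fun e : Entry => !e.isActive) he
  rw [hmk, shapes_node, shapes_append, shapes_append, shapes_map_setEdge]
  -- Leading and trailing permanent children contribute nothing to the local shape, so trimming them
  -- leaves it unchanged.
  have hs : (passUp mid).shape = blockShape (lead ++ (mid ++ trail)) := by
    simp [passUp, blockShape, filterMap_shape_of_not_active hlead,
      filterMap_shape_of_not_active htrail]
  rw [hs, List.map_append, List.map_append, List.sum_append, List.sum_append, ← add_assoc]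
  exact Multiset.cons_le_cons _ (add_le_add (add_le_add (shapes_linkAll_le _ _ _)
    (shapes_blockExt_le _ _ _)) (shapes_linkAll_le _ _ _))

/-! ### Greedy packing -/

/-- The number of nodes of an active component; permanent children contribute nothing. -/
def Entry.activeSize : Entry → ℕ
  | .active a => a.shape.size
  | .permanent _ => 0

/-- The number of nodes in the active components of `es`. -/
def activeSizes (es : List Entry) : ℕ := (es.map Entry.activeSize).sum

/-- The number of permanent children in `es`. -/
def numPermanent (es : List Entry) : ℕ := es.countP fun e => !e.isActive

theorem OrdinalTree.size_pos (t : OrdinalTree) : 0 < t.size := by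
  cases t
  rw [size]
  omega

@[simp] theorem activeSizes_append (es es' : List Entry) :
    activeSizes (es ++ es') = activeSizes es + activeSizes es' := by
  simp [activeSizes]

@[simp] theorem activeSizes_cons (e : Entry) (es : List Entry) :
    activeSizes (e :: es) = e.activeSize + activeSizes es := by
  simp [activeSizes]

@[simp] theorem activeSizes_nil : activeSizes [] = 0 := rfl

theorem numPermanent_active_cons (a : Active) (es : List Entry) :
    numPermanent (.active a :: es) = numPermanent es := by
  simp [numPermanent, Entry.isActive]

theorem numPermanent_permanent_cons (ts : List TopTree) (es : List Entry) :
    numPermanent (.permanent ts :: es) = numPermanent es + 1 := by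
  simp [numPermanent, Entry.isActive]

theorem size_blockShape (es : List Entry) : (blockShape es).size = 1 + activeSizes es := by
  rw [blockShape, OrdinalTree.size]
  congr 1
  induction es with
  | nil => rfl
  | cons e es ih =>
    cases e with
    | active a =>
      rw [List.filterMap_cons_some (f := Entry.shape?) (b := a.shape) rfl,
        OrdinalTree.sizeForest, ih, activeSizes_cons, Entry.activeSize]
    | permanent ts =>
      rw [List.filterMap_cons_none (f := Entry.shape?) rfl, ih, activeSizes_cons,
        Entry.activeSize, zero_add]

theorem activeSizes_pos {es : List Entry} (h : es.any Entry.isActive = true) :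
    0 < activeSizes es := by
  obtain ⟨e, he, ha⟩ := List.any_eq_true.1 h
  refine lt_of_lt_of_le ?_ (List.single_le_sum (by simp) _ (List.mem_map_of_mem he))
  cases e with
  | active a => exact a.shape.size_pos
  | permanent ts => simp [Entry.isActive] at ha

/-- Blocks are consecutive segments of the list of children, so they cut the right spine of the
first-child next-sibling encoding into intervals. -/
theorem pack_flatten (B : ℕ) (br : Bool) (es : List Entry) :
    ∀ cur, (pack B br cur es).flatten = cur ++ es := by
  induction es with
  | nil => simp [pack]
  | cons e es ih =>
    intro cur
    rw [pack]
    split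
    · simp [ih]
    · simp [ih]

/-- Each closed block followed by another one is charged `B`. If it has reached size `B`, its
children have `a ≥ 1` nodes with `1 + a ≥ B`, so `2 * a ≥ B`. Otherwise the node is branching and
the block ends with a permanent child, which is charged instead. The summand `B` is for the last
block. -/
theorem mul_length_pack_le (B : ℕ) (br : Bool) (es : List Entry) :
    ∀ cur, B * (pack B br cur es).length ≤ 2 * activeSizes (cur ++ es) + B +
      (if br then B * numPermanent (cur ++ es) else 0) := by
  induction es with
  | nil =>
    intro cur
    simp only [pack, List.length_singleton]
    omega
  | cons e es ih =>
    intro cur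
    rw [pack]
    split
    · rename_i h
      rw [Bool.and_eq_true, isClosed, Bool.and_eq_true, Bool.or_eq_true, decide_eq_true_eq,
        size_blockShape, Bool.and_eq_true] at h
      obtain ⟨⟨hact, hB⟩, -⟩ := h
      have hpos := activeSizes_pos hact
      have := ih [e]
      rw [List.length_cons, mul_add, mul_one]
      simp only [activeSizes_cons, activeSizes_append, numPermanent, List.countP_append,
        List.nil_append, List.cons_append] at this ⊢
      rcases hB with hB | ⟨rfl, hB⟩
      · cases br with
        | false => simp only [Bool.false_eq_true, if_false] at this ⊢; omega
        | true => simp only [if_true, mul_add] at this ⊢; omega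
      · have hp : 1 ≤ cur.countP fun e => !e.isActive := by
          rw [Nat.one_le_iff_ne_zero, ← Nat.pos_iff_ne_zero, List.countP_pos_iff]
          rw [Option.any_eq_true] at hB
          obtain ⟨x, hx, hxa⟩ := hB
          exact ⟨x, List.mem_of_getLast? hx, hxa⟩
        have hBp := Nat.mul_le_mul_left B hp
        simp only [if_true, mul_add] at this ⊢
        omega
    · have := ih (cur ++ [e])
      simpa using this

theorem pack_eq_singleton (B : ℕ) (es : List Entry) :
    ∀ cur, 1 + activeSizes (cur ++ es) < B → pack B false cur es = [cur ++ es] := by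
  induction es with
  | nil => simp [pack]
  | cons e es ih =>
    intro cur h
    have hc : isClosed B false cur = false := by
      rw [activeSizes_append] at h
      simp only [isClosed, size_blockShape, Bool.false_and, Bool.or_false, Bool.and_eq_false_imp,
        decide_eq_false_iff_not]
      omega
    rw [pack, hc, Bool.false_and, if_neg (by simp), ih _ (by simpa using h)]
    simp

/-- A block absorbs another active component only if it has fewer than `B` nodes or consists of the
root alone, and the component itself has fewer than `B` nodes. -/
theorem size_blockShape_le_of_mem_pack {B : ℕ} {br : Bool} (es : List Entry) :
    ∀ cur, (∀ e ∈ es, e.activeSize < B) → (blockShape cur).size ≤ 2 * B →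
      ∀ b ∈ pack B br cur es, (blockShape b).size ≤ 2 * B := by
  induction es with
  | nil =>
    intro cur _ hcur b hb
    rw [pack, List.mem_singleton] at hb
    rwa [hb]
  | cons e es ih =>
    intro cur hes hcur b hb
    have he := hes e (by simp)
    rw [pack] at hb
    split at hb
    · rcases List.mem_cons.1 hb with rfl | hb
      · exact hcur
      · refine ih [e] (fun e' h => hes e' (by simp [h])) ?_ b hb
        rw [size_blockShape]
        simp
        omega
    · rename_i h
      refine ih (cur ++ [e]) (fun e' h => hes e' (by simp [h])) ?_ b hb
      rw [size_blockShape, activeSizes_append, activeSizes_cons, activeSizes_nil, add_zero]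
      rw [size_blockShape] at hcur
      cases e with
      | permanent ts => simpa [Entry.activeSize] using hcur
      | active a =>
        simp only [Entry.isActive, Bool.and_true, isClosed, Bool.and_eq_true, Bool.or_eq_true,
          decide_eq_true_eq, size_blockShape, not_and_or, not_or] at h
        rcases h with h | ⟨h, -⟩
        · have : activeSizes cur = 0 := by
            rw [activeSizes, List.sum_eq_zero_iff]
            intro x hx
            obtain ⟨e', he', rfl⟩ := List.mem_map.1 hx
            cases e' with
            | permanent ts => rfl
            | active a => exact absurd (List.any_eq_true.2 ⟨_, he', rfl⟩) h
          omega
        · omega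

end Hypersuccinct
namespace Hypersuccinct

/-! ### Costs of a forest and of its components -/

/-- The cost of a full binary tree whose root has history `h`. -/
def CostModel.total (φ : CostModel) (h : List Bool) : FullBinaryTree → ℝ
  | .leaf => φ.leaf h
  | .node l r => φ.inner h + φ.total (h ++ [false]) l + φ.total (h ++ [true]) r

/-- The total weight of the shapes of components. -/
def weightSum (w : OrdinalTree → ℝ) (S : Multiset OrdinalTree) : ℝ := (S.map w).sum

@[simp] theorem weightSum_zero (w : OrdinalTree → ℝ) : weightSum w 0 = 0 := rfl

@[simp] theorem weightSum_add (w : OrdinalTree → ℝ) (S S' : Multiset OrdinalTree) :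
    weightSum w (S + S') = weightSum w S + weightSum w S' := by
  simp [weightSum]

@[simp] theorem weightSum_cons (w : OrdinalTree → ℝ) (s : OrdinalTree)
    (S : Multiset OrdinalTree) : weightSum w (s ::ₘ S) = w s + weightSum w S := by
  simp [weightSum]

theorem weightSum_nonneg {w : OrdinalTree → ℝ} (hw : ∀ s, 0 ≤ w s) (S : Multiset OrdinalTree) :
    0 ≤ weightSum w S := by
  refine Multiset.sum_nonneg fun x hx => ?_
  obtain ⟨s, _, rfl⟩ := Multiset.mem_map.1 hx
  exact hw s

theorem weightSum_mono {w : OrdinalTree → ℝ} (hw : ∀ s, 0 ≤ w s) {S S' : Multiset OrdinalTree}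
    (h : S ≤ S') : weightSum w S ≤ weightSum w S' := by
  obtain ⟨R, rfl⟩ := Multiset.le_iff_exists_add.1 h
  rw [weightSum_add]
  exact le_add_of_nonneg_right (weightSum_nonneg hw R)

/-- The shapes of all permanent components below several children. -/
def shapesBelow (es : List Entry) : Multiset OrdinalTree := (es.map Entry.shapesBelow).sum

@[simp] theorem shapesBelow_nil : shapesBelow [] = 0 := rfl

@[simp] theorem shapesBelow_cons (e : Entry) (es : List Entry) :
    shapesBelow (e :: es) = e.shapesBelow + shapesBelow es := by
  simp [shapesBelow]

/-- The weight of a shape exceeds the cost of any annotation by at most `K`, which also bounds the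
cost of stopping or skipping. -/
structure Admissible (φ : CostModel) (w : OrdinalTree → ℝ) (K : ℝ) : Prop where
  leaf_nonneg : ∀ h, 0 ≤ φ.leaf h
  inner_nonneg : ∀ h, 0 ≤ φ.inner h
  weight_nonneg : ∀ s, 0 ≤ w s
  nonneg : 0 ≤ K
  cut_le : φ.cut ≤ K
  weight_le : ∀ h A, w (.node (Annotation.erase A)) ≤ A.cost φ h + K

theorem Admissible.total_nonneg {φ : CostModel} {w : OrdinalTree → ℝ} {K : ℝ}
    (hφ : Admissible φ w K) (b : FullBinaryTree) : ∀ h, 0 ≤ φ.total h b := by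
  induction b with
  | leaf => exact hφ.leaf_nonneg
  | node l r ihl ihr =>
    intro h
    exact add_nonneg (add_nonneg (hφ.inner_nonneg h) (ihl _)) (ihr _)

/-- The entries of the trees of a forest whose first node has history `h`: up to `N` times `K`, the
cost of the forest covers the weights of all permanent components and the costs of the active
components. -/
inductive EntriesFit (φ : CostModel) (w : OrdinalTree → ℝ) (K : ℝ) :
    List Bool → List OrdinalTree → List Entry → ℕ → Prop
  | nil (h : List Bool) : EntriesFit φ w K h [] [] 0
  | active {h : List Bool} {f g : List OrdinalTree} {a : Active} {es : List Entry} {N N' : ℕ}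
      (A : Annotation) (hA : a.shape = .node A.erase)
      (hcost : A.cost φ (h ++ [false]) + weightSum w (Entry.active a).shapesBelow ≤
        φ.total (h ++ [false]) (fcns f) + K * N)
      (htail : EntriesFit φ w K (h ++ [true]) g es N') :
      EntriesFit φ w K h (.node f :: g) (.active a :: es) (N + N')
  | permanent {h : List Bool} {f g : List OrdinalTree} {ts : List TopTree} {es : List Entry}
      {N N' : ℕ} (hcost : weightSum w (shapes ts) ≤ φ.total (h ++ [false]) (fcns f) + K * N)
      (htail : EntriesFit φ w K (h ++ [true]) g es N') :
      EntriesFit φ w K h (.node f :: g) (.permanent ts :: es) (N + N' + 1)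

variable {φ : CostModel} {w : OrdinalTree → ℝ} {K : ℝ}

/-- Splits one block off the list of entries. Its annotation ends with `halt`, which is what the
last `K` pays for; the costs of the remaining siblings stay available for later blocks. -/
theorem EntriesFit.exists_annotation_prefix (hφ : Admissible φ w K) (rest : List Entry) :
    ∀ (b : List Entry) {h : List Bool} {f : List OrdinalTree} {N : ℕ},
      EntriesFit φ w K h f (b ++ rest) N →
      ∃ (A : Annotation) (h' : List Bool) (f' : List OrdinalTree) (N₁ N₂ : ℕ), N = N₁ + N₂ ∧
        EntriesFit φ w K h' f' rest N₂ ∧ A.erase = b.filterMap Entry.shape? ∧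
        A.cost φ h + weightSum w (shapesBelow b) + φ.total h' (fcns f') ≤
          φ.total h (fcns f) + K * N₁ + K := by
  intro b
  induction b with
  | nil =>
    intro h f N hfit
    refine ⟨.halt, h, f, 0, N, (zero_add N).symm, hfit, rfl, ?_⟩
    have := hφ.cut_le
    simp only [Annotation.cost, shapesBelow_nil, weightSum_zero, Nat.cast_zero, mul_zero]
    linarith
  | cons e b ih =>
    intro h f N hfit
    rw [List.cons_append] at hfit
    cases hfit with
    | active A hA hcost htail =>
      obtain ⟨A', h', f', N₁, N₂, rfl, hrest, her, hle⟩ := ih htail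
      refine ⟨.node A A', h', f', _, N₂, (add_assoc _ N₁ N₂).symm, hrest, ?_, ?_⟩
      · rw [List.filterMap_cons_some (f := Entry.shape?) rfl, hA, ← her, Annotation.erase]
      · simp only [Annotation.cost, shapesBelow_cons, weightSum_add, fcns, CostModel.total,
          Nat.cast_add]
        linarith
    | permanent hcost htail =>
      obtain ⟨A', h', f', N₁, N₂, rfl, hrest, her, hle⟩ := ih htail
      rename_i N'
      -- The extra `1` pays for the skip. The cost of the inner node at `h` is simply dropped: it
      -- stands for the root of the skipped child, and roots of micro trees are not coded.
      refine ⟨.skip A', h', f', N' + N₁ + 1, N₂, by omega, hrest, ?_, ?_⟩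
      · rw [List.filterMap_cons_none (f := Entry.shape?) rfl, ← her, Annotation.erase]
      · have := hφ.cut_le
        have := hφ.inner_nonneg h
        simp only [Annotation.cost, shapesBelow_cons, weightSum_add, fcns, CostModel.total,
          Nat.cast_add, Nat.cast_one, Entry.shapesBelow]
        linarith

/-- Taking all entries at once lets the annotation end at the true leaf instead of a `halt`. No cut
is charged, so a light subtree can be passed up with `N = 0`. -/
theorem EntriesFit.exists_annotation (hφ : Admissible φ w K) {h : List Bool}
    {f : List OrdinalTree} {es : List Entry} {N : ℕ} (hfit : EntriesFit φ w K h f es N) :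
    ∃ A : Annotation, A.erase = es.filterMap Entry.shape? ∧
      A.cost φ h + weightSum w (shapesBelow es) ≤ φ.total h (fcns f) + K * N := by
  induction hfit with
  | nil h => exact ⟨.leaf, rfl, by simp [Annotation.cost, fcns, CostModel.total]⟩
  | active A hA hcost htail ih =>
    obtain ⟨A', her, hle⟩ := ih
    refine ⟨.node A A', ?_, ?_⟩
    · rw [List.filterMap_cons_some (f := Entry.shape?) rfl, hA, ← her, Annotation.erase]
    · simp only [Annotation.cost, shapesBelow_cons, weightSum_add, fcns, CostModel.total,
        Nat.cast_add]
      linarith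
  | @permanent h f g ts es N N' hcost htail ih =>
    obtain ⟨A', her, hle⟩ := ih
    refine ⟨.skip A', ?_, ?_⟩
    · rw [List.filterMap_cons_none (f := Entry.shape?) rfl, ← her, Annotation.erase]
    · have := hφ.cut_le
      have := hφ.inner_nonneg h
      simp only [Annotation.cost, shapesBelow_cons, weightSum_add, fcns, CostModel.total,
        Nat.cast_add, Nat.cast_one, Entry.shapesBelow]
      linarith

theorem weightSum_makePermanent_le (hφ : Admissible φ w K) {es : List Entry} {A : Annotation}
    (hA : A.erase = es.filterMap Entry.shape?) (h : List Bool) :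
    weightSum w (shapes [makePermanent es]) ≤
      A.cost φ h + weightSum w (shapesBelow es) + K := by
  have h1 := weightSum_mono hφ.weight_nonneg (shapes_makePermanent_le es)
  have h2 := hφ.weight_le h A
  rw [weightSum_cons, blockShape, ← hA] at h1
  change _ ≤ _ + weightSum w (shapesBelow es) at h1
  linarith

/-- Each block costs two units of `K`: one for its `halt`, one for the excess of the weight of its
shape over the cost of the annotation. -/
theorem EntriesFit.weightSum_le (hφ : Admissible φ w K) (bs : List (List Entry)) :
    ∀ {h : List Bool} {f : List OrdinalTree} {N : ℕ}, EntriesFit φ w K h f bs.flatten N →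
      weightSum w (shapes (bs.map makePermanent)) ≤
        φ.total h (fcns f) + K * (N + 2 * bs.length : ℕ) := by
  induction bs with
  | nil =>
    intro h f N _
    exact add_nonneg (hφ.total_nonneg _ _) (mul_nonneg hφ.nonneg (Nat.cast_nonneg _))
  | cons b bs ih =>
    intro h f N hfit
    obtain ⟨A, h', f', N₁, N₂, rfl, hrest, her, hle⟩ := hfit.exists_annotation_prefix hφ _ b
    have h1 := weightSum_makePermanent_le hφ her h
    have h2 := ih hrest
    rw [List.map_cons, shapes_cons, weightSum_add]
    push_cast [List.length_cons] at h2 ⊢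
    linarith

/-! ### The decomposition -/

/-- The outcome of the decomposition at a tree with children `f` whose root has history `h`. -/
def OutcomeFits (φ : CostModel) (w : OrdinalTree → ℝ) (K : ℝ) (B : ℕ) (h : List Bool)
    (f : List OrdinalTree) : Outcome → Prop
  | .active es => ∃ (N : ℕ) (A : Annotation), A.erase = es.filterMap Entry.shape? ∧
      A.cost φ (h ++ [false]) + weightSum w (shapesBelow es) ≤
        φ.total (h ++ [false]) (fcns f) + K * N ∧
      ((OrdinalTree.node f).size < B →
        N = 0 ∧ (blockShape es).size = (OrdinalTree.node f).size) ∧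
      (B ≤ (OrdinalTree.node f).size →
        B * N + 11 * B + 18 * (blockShape es).size ≤ 18 * (OrdinalTree.node f).size)
  | .permanent ts => B ≤ (OrdinalTree.node f).size ∧
      ∃ N : ℕ, weightSum w (shapes ts) ≤ φ.total (h ++ [false]) (fcns f) + K * N ∧
        B * N + 12 * B ≤ 18 * (OrdinalTree.node f).size

/-- The outcomes of the decomposition at the trees of a forest whose first node has history `h`. -/
inductive OutcomesFit (φ : CostModel) (w : OrdinalTree → ℝ) (K : ℝ) (B : ℕ) :
    List Bool → List OrdinalTree → List (Bool × Outcome) → Prop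
  | nil (h : List Bool) : OutcomesFit φ w K B h [] []
  | cons {h : List Bool} {f g : List OrdinalTree} {o : Outcome} {cs : List (Bool × Outcome)}
      (ho : OutcomeFits φ w K B h f o) (hcs : OutcomesFit φ w K B (h ++ [true]) g cs) :
      OutcomesFit φ w K B h (.node f :: g) ((decide (B ≤ (OrdinalTree.node f).size), o) :: cs)

theorem weightSum_passUp_le (hφ : Admissible φ w K) (es : List Entry) :
    weightSum w (Entry.active (passUp es)).shapesBelow ≤ weightSum w (shapesBelow es) :=
  weightSum_mono hφ.weight_nonneg (shapes_blockExt_le es 1 0)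

/-- Token count: each node brings 18 tokens, and a unit of `N` costs `B` of them. A heavy child
leaves a surplus of `11 * B`: an active one by its invariant, a permanent one with `12 * B` after
paying for its skip. Nodes in active components keep their tokens. -/
theorem OutcomesFit.entriesFit_of_not_branching (hφ : Admissible φ w K) {B : ℕ} {h : List Bool}
    {f : List OrdinalTree} {cs : List (Bool × Outcome)} (hfit : OutcomesFit φ w K B h f cs) :
    ∃ N, EntriesFit φ w K h f (cs.map fun c => toEntry false c.1 c.2) N ∧
      B * N + 11 * (B * cs.countP fun c => c.1) +
        18 * activeSizes (cs.map fun c => toEntry false c.1 c.2) ≤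
          18 * OrdinalTree.sizeForest f ∧
      ((cs.countP fun c => c.1) = 0 → N = 0 ∧
        activeSizes (cs.map fun c => toEntry false c.1 c.2) = OrdinalTree.sizeForest f) ∧
      ((cs.countP fun c => c.1) ≠ 0 → B ≤ OrdinalTree.sizeForest f) := by
  induction hfit with
  | nil h => exact ⟨0, .nil h, by simp [OrdinalTree.sizeForest], by simp [OrdinalTree.sizeForest],
      by simp⟩
  | @cons h f g o cs ho hcs ih =>
    obtain ⟨N', hN', hle, hzero, hheavy'⟩ := ih
    cases o with
    | active es =>
      obtain ⟨N, A, hA, hcost, hlight, hheavy⟩ := ho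
      refine ⟨N + N', .active A (by rw [hA]; rfl) ?_ hN', ?_⟩
      · exact le_trans (add_le_add_right (weightSum_passUp_le hφ es) _) hcost
      · have hsz : Entry.activeSize (toEntry false (decide (B ≤ (OrdinalTree.node f).size))
            (.active es)) = (blockShape es).size := rfl
        simp only [List.map_cons, activeSizes_cons, hsz, OrdinalTree.sizeForest, mul_add,
          List.countP_cons]
        by_cases hB : B ≤ (OrdinalTree.node f).size
        · have := hheavy hB
          simp only [hB, decide_true, if_true, mul_one]
          omega
        · obtain ⟨rfl, hs⟩ := hlight (not_le.1 hB)
          simp only [hB, decide_false, Bool.false_eq_true, if_false, add_zero, mul_zero]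
          omega
    | permanent ts =>
      obtain ⟨hB, N, hcost, hN⟩ := ho
      refine ⟨N + N' + 1, .permanent hcost hN', ?_⟩
      have hsz : ∀ b, Entry.activeSize (toEntry false b (.permanent ts)) = 0 := fun _ => rfl
      simp only [List.map_cons, activeSizes_cons, hsz, OrdinalTree.sizeForest, mul_add,
        List.countP_cons, hB, decide_true, if_true, mul_one]
      omega

/-- At a branching node an active heavy child is made permanent. This uses two units, one for the
new micro tree and one for the skip, so its surplus falls from `11 * B` to `9 * B`. -/
theorem OutcomesFit.entriesFit_of_branching (hφ : Admissible φ w K) {B : ℕ} {h : List Bool}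
    {f : List OrdinalTree} {cs : List (Bool × Outcome)} (hfit : OutcomesFit φ w K B h f cs) :
    ∃ N, EntriesFit φ w K h f (cs.map fun c => toEntry true c.1 c.2) N ∧
      B * N + 9 * (B * cs.countP fun c => c.1) +
        18 * activeSizes (cs.map fun c => toEntry true c.1 c.2) ≤
          18 * OrdinalTree.sizeForest f ∧
      numPermanent (cs.map fun c => toEntry true c.1 c.2) = cs.countP fun c => c.1 := by
  induction hfit with
  | nil h => exact ⟨0, .nil h, by simp [OrdinalTree.sizeForest], rfl⟩
  | @cons h f g o cs ho hcs ih =>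
    obtain ⟨N', hN', hle, hnum⟩ := ih
    cases o with
    | active es =>
      obtain ⟨N, A, hA, hcost, hlight, hheavy⟩ := ho
      by_cases hB : B ≤ (OrdinalTree.node f).size
      · have he : toEntry true (decide (B ≤ (OrdinalTree.node f).size)) (.active es) =
            .permanent [makePermanent es] := by simp [toEntry, hB, Outcome.sealed]
        refine ⟨N + 1 + N' + 1, ?_, ?_⟩
        · rw [List.map_cons, he]
          refine .permanent ?_ hN'
          have := weightSum_makePermanent_le hφ hA (h ++ [false])
          push_cast
          linarith
        · have := hheavy hB
          rw [List.map_cons, he]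
          simp only [List.countP_cons, numPermanent_permanent_cons, hnum, activeSizes_cons,
            Entry.activeSize, OrdinalTree.sizeForest, mul_add, hB,
            decide_true, if_true, mul_one, and_true]
          omega
      · obtain ⟨rfl, hs⟩ := hlight (not_le.1 hB)
        have he : toEntry true (decide (B ≤ (OrdinalTree.node f).size)) (.active es) =
            .active (passUp es) := by simp [toEntry, hB]
        refine ⟨0 + N', ?_, ?_⟩
        · rw [List.map_cons, he]
          exact .active A (by rw [hA]; rfl)
            (le_trans (add_le_add_right (weightSum_passUp_le hφ es) _) hcost) hN'
        · have hsz : (Entry.active (passUp es)).activeSize = (blockShape es).size := rfl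
          rw [List.map_cons, he]
          simp only [List.countP_cons, numPermanent_active_cons, hnum, activeSizes_cons, hsz,
            OrdinalTree.sizeForest, mul_add, hB, decide_false, Bool.false_eq_true, if_false, add_zero, and_true]
          omega
    | permanent ts =>
      obtain ⟨hB, N, hcost, hN⟩ := ho
      refine ⟨N + N' + 1, .permanent hcost hN', ?_⟩
      have he : toEntry true (decide (B ≤ (OrdinalTree.node f).size))
          (.permanent ts) = .permanent ts := rfl
      rw [List.map_cons, he]
      simp only [List.countP_cons, numPermanent_permanent_cons, hnum, activeSizes_cons,
            Entry.activeSize, OrdinalTree.sizeForest, mul_add, hB,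
        decide_true, if_true, mul_one, and_true]
      omega

/-- Unifies the branches of `combine`: a single sealed block is an instance of sealing all blocks.
Without branching, sealing implies that root and active components have at least `B` nodes together,
as otherwise no block would ever close. -/
theorem combine_cases (B : ℕ) (cs : List (Bool × Outcome)) (br : Bool)
    (hbr : br = decide (2 ≤ cs.countP fun c => c.1)) (es : List Entry)
    (hes : es = cs.map fun c => toEntry br c.1 c.2) :
    (br = false ∧ (blockShape es).size < B ∧ combine B cs = .active es) ∨
      (combine B cs = .permanent ((pack B br [] es).map makePermanent) ∧
        (br = true ∨ B ≤ (blockShape es).size)) := by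
  have hflat := pack_flatten B br es []
  have hsingle := pack_eq_singleton B es []
  rw [List.nil_append] at hflat hsingle
  rw [combine, ← hbr, ← hes]
  split
  · rename_i b hb
    rw [hb, List.flatten_singleton] at hflat
    subst hflat
    split
    · rename_i h
      rw [Bool.and_eq_true, Bool.not_eq_true', decide_eq_true_eq] at h
      exact Or.inl ⟨h.1, h.2, rfl⟩
    · rename_i h
      refine Or.inr ⟨by rw [hb]; rfl, ?_⟩
      cases br with
      | true => exact Or.inl rfl
      | false => simpa using h
  · rename_i hne
    refine Or.inr ⟨rfl, ?_⟩
    cases br with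
    | true => exact Or.inl rfl
    | false =>
      right
      by_contra hlt
      rw [size_blockShape] at hlt
      exact hne _ (hsingle (by omega))

/-- The constants balance here. With `a` active nodes, sealing all blocks takes two units per block,
and the surplus `12 * B` must remain. At a branching node with `j ≥ 2` heavy children this asks for
`4 * a + 14 * B + 2 * B * j` tokens, and `9 * B * j + 18 * a` are there, since `7 * j ≥ 14`. At
other nodes it asks for `4 * a + 14 * B`, covered by `18 * (1 + a)` because `B ≤ 1 + a`. -/
theorem OutcomesFit.combine (hφ : Admissible φ w K) {B : ℕ} {h : List Bool}
    {f : List OrdinalTree} {cs : List (Bool × Outcome)}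
    (hfit : OutcomesFit φ w K B (h ++ [false]) f cs) :
    OutcomeFits φ w K B h f (combine B cs) := by
  have hsize : (OrdinalTree.node f).size = 1 + OrdinalTree.sizeForest f := by
    rw [OrdinalTree.size]
  by_cases hj : 2 ≤ cs.countP fun c => c.1
  · obtain ⟨N, hN, hle, hnum⟩ := hfit.entriesFit_of_branching hφ
    rcases combine_cases B cs true (by simp [hj]) _ rfl with ⟨h0, -⟩ | ⟨hc, -⟩
    · simp at h0
    · rw [hc]
      have hq := mul_length_pack_le B true (cs.map fun c => toEntry true c.1 c.2) []
      simp only [List.nil_append, if_true, hnum] at hq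
      have hBj := Nat.mul_le_mul_left B hj
      refine ⟨by omega, _, EntriesFit.weightSum_le hφ _ (by
        rw [pack_flatten]; exact hN), ?_⟩
      rw [mul_add, mul_left_comm]
      omega
  · obtain ⟨N, hN, hle, hzero, hheavy⟩ := hfit.entriesFit_of_not_branching hφ
    rcases combine_cases B cs false (by simpa using hj) _ rfl with ⟨-, hlt, hc⟩ | ⟨hc, hge⟩
    · rw [hc]
      rw [size_blockShape] at hlt
      obtain ⟨A, hA, hcost⟩ := hN.exists_annotation hφ
      refine ⟨N, A, hA, hcost, ?_, ?_⟩
      · intro hB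
        have hj0 : (cs.countP fun c => c.1) = 0 := by
          by_contra hj0
          have := hheavy hj0
          omega
        obtain ⟨rfl, hs⟩ := hzero hj0
        rw [size_blockShape]
        omega
      · intro hB
        have hj1 : (cs.countP fun c => c.1) = 1 := by
          by_contra hj1
          obtain ⟨rfl, hs⟩ := hzero (by omega)
          omega
        rw [hj1] at hle
        rw [size_blockShape]
        omega
    · rw [hc]
      have hge : B ≤ 1 + activeSizes (cs.map fun c => toEntry false c.1 c.2) := by
        rw [size_blockShape] at hge
        simpa using hge
      have hq := mul_length_pack_le B false (cs.map fun c => toEntry false c.1 c.2) []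
      simp only [List.nil_append, Bool.false_eq_true, if_false, add_zero] at hq
      refine ⟨by omega, _, EntriesFit.weightSum_le hφ _ (by
        rw [pack_flatten]; exact hN), ?_⟩
      rw [mul_add, mul_left_comm]
      by_cases hj0 : (cs.countP fun c => c.1) = 0
      · obtain ⟨rfl, hs⟩ := hzero hj0
        omega
      · have hj1 : (cs.countP fun c => c.1) = 1 := by omega
        rw [hj1] at hle
        omega

theorem outcomesFit_decomposeForest (hφ : Admissible φ w K) (B : ℕ) (f : List OrdinalTree) :
    ∀ h, OutcomesFit φ w K B h f (decomposeForest B f) := by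
  induction f using forest_induction with
  | nil => exact .nil
  | cons f g hf hg =>
    intro h
    rw [decomposeForest, decompose]
    exact .cons ((hf _).combine hφ) (hg _)

/-- The total weight of the micro trees of a tree, compared with its cost. -/
theorem weightSum_topTier_le (hφ : Admissible φ w K) {B : ℕ} (f : List OrdinalTree)
    (h : List Bool) : ∃ N : ℕ, B * N ≤ 18 * (OrdinalTree.node f).size + B ∧
      weightSum w (shapes (topTier B (.node f))) ≤ φ.total (h ++ [false]) (fcns f) + K * N := by
  have hout : OutcomeFits φ w K B h f (decompose B (.node f)) := by
    rw [decompose]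
    exact (outcomesFit_decomposeForest hφ B f _).combine hφ
  rw [topTier]
  generalize decompose B (.node f) = o at hout
  cases o with
  | active es =>
    obtain ⟨N, A, hA, hcost, hlight, hheavy⟩ := hout
    -- One more unit, for sealing the component that is still active at the root of the tree.
    refine ⟨N + 1, ?_, ?_⟩
    · rw [mul_add, mul_one]
      by_cases hB : B ≤ (OrdinalTree.node f).size
      · have := hheavy hB
        omega
      · obtain ⟨rfl, -⟩ := hlight (not_le.1 hB)
        omega
    · have := weightSum_makePermanent_le hφ hA (h ++ [false])
      rw [Outcome.sealed]
      push_cast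
      linarith
  | permanent ts =>
    obtain ⟨-, N, hcost, hN⟩ := hout
    exact ⟨N, by omega, hcost⟩

/-! ### The sizes of micro trees -/

/-- The components are small. -/
def Outcome.IsSmall (B : ℕ) : Outcome → Prop
  | .active es => (blockShape es).size < B ∧ ∀ s ∈ shapesBelow es, s.size ≤ 2 * B
  | .permanent ts => ∀ s ∈ shapes ts, s.size ≤ 2 * B

theorem size_le_of_mem_shapes_makePermanent {B : ℕ} {es : List Entry}
    (hs : (blockShape es).size ≤ 2 * B) (hes : ∀ s ∈ shapesBelow es, s.size ≤ 2 * B) :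
    ∀ s ∈ shapes [makePermanent es], s.size ≤ 2 * B := by
  intro s hmem
  rcases Multiset.mem_cons.1 (Multiset.mem_of_le (shapes_makePermanent_le es) hmem) with rfl | h
  · exact hs
  · exact hes s h

theorem mem_shapesBelow {es : List Entry} {s : OrdinalTree} :
    s ∈ shapesBelow es ↔ ∃ e ∈ es, s ∈ e.shapesBelow := by
  induction es with
  | nil => simp
  | cons e es ih => simp [ih]

theorem Outcome.IsSmall.sealed {B : ℕ} {o : Outcome} (ho : o.IsSmall B) :
    ∀ s ∈ shapes o.sealed, s.size ≤ 2 * B := by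
  cases o with
  | active es => exact size_le_of_mem_shapes_makePermanent (by have := ho.1; omega) ho.2
  | permanent ts => exact ho

theorem Outcome.IsSmall.combine {B : ℕ} (hB : 1 ≤ B) {cs : List (Bool × Outcome)}
    (hcs : ∀ c ∈ cs, c.2.IsSmall B) : (combine B cs).IsSmall B := by
  obtain ⟨br, hbr⟩ : ∃ br, br = decide (2 ≤ cs.countP fun c => c.1) := ⟨_, rfl⟩
  obtain ⟨es, hes⟩ : ∃ es, es = cs.map fun c => toEntry br c.1 c.2 := ⟨_, rfl⟩
  have hsmall : ∀ e ∈ es, e.activeSize < B ∧ ∀ s ∈ e.shapesBelow, s.size ≤ 2 * B := by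
    rw [hes]
    intro e he
    obtain ⟨⟨heavy, o⟩, hc, rfl⟩ := List.mem_map.1 he
    have ho := hcs _ hc
    dsimp only at ho ⊢
    cases o with
    | permanent ts => exact ⟨hB, ho⟩
    | active es' =>
      rw [toEntry]
      split
      · exact ⟨hB, ho.sealed⟩
      · exact ⟨ho.1, fun s hs => ho.2 s (Multiset.mem_of_le (shapes_blockExt_le es' 1 0) hs)⟩
  have hbelow : ∀ s ∈ shapesBelow es, s.size ≤ 2 * B := by
    intro s hs
    obtain ⟨e, he, hs⟩ := mem_shapesBelow.1 hs
    exact (hsmall e he).2 s hs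
  rcases combine_cases B cs br hbr es hes with ⟨-, hlt, hc⟩ | ⟨hc, -⟩
  · rw [hc]
    exact ⟨hlt, hbelow⟩
  · rw [hc]
    have hsz := size_blockShape_le_of_mem_pack (br := br) es [] (fun e he => (hsmall e he).1)
      (by rw [size_blockShape, activeSizes_nil]; omega)
    have hflat := pack_flatten B br es []
    rw [List.nil_append] at hflat
    have hmem : ∀ b ∈ pack B br [] es, ∀ s ∈ shapesBelow b, s.size ≤ 2 * B := by
      intro b hb s hs
      obtain ⟨e, he, hs⟩ := mem_shapesBelow.1 hs
      refine (hsmall e ?_).2 s hs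
      rw [← hflat]
      exact List.mem_flatten.2 ⟨b, hb, he⟩
    generalize pack B br [] es = bs at hsz hmem
    change ∀ s ∈ shapes (bs.map makePermanent), s.size ≤ 2 * B
    induction bs with
    | nil => simp
    | cons b bs ih =>
      intro s hs
      rw [List.map_cons, shapes_cons, Multiset.mem_add] at hs
      rcases hs with hs | hs
      · exact size_le_of_mem_shapes_makePermanent (hsz b (by simp)) (hmem b (by simp)) s hs
      · exact ih (fun b' hb' => hsz b' (by simp [hb'])) (fun b' hb' => hmem b' (by simp [hb'])) s hs

theorem isSmall_decomposeForest {B : ℕ} (hB : 1 ≤ B) (f : List OrdinalTree) :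
    ∀ c ∈ decomposeForest B f, c.2.IsSmall B := by
  induction f using forest_induction with
  | nil => simp [decomposeForest]
  | cons f g hf hg =>
    intro c hc
    rw [decomposeForest, decompose] at hc
    rcases List.mem_cons.1 hc with rfl | hc
    · exact Outcome.IsSmall.combine hB hf
    · exact hg c hc

/-- Micro trees have at most `2 B` nodes. -/
theorem size_le_of_mem_shapes_topTier {B : ℕ} (hB : 1 ≤ B) (t : OrdinalTree) :
    ∀ s ∈ shapes (topTier B t), s.size ≤ 2 * B := by
  obtain ⟨f⟩ := t
  rw [topTier, decompose]
  exact (Outcome.IsSmall.combine hB (isSmall_decomposeForest hB f)).sealed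

end Hypersuccinct
namespace Hypersuccinct

/-! ### The cost model given by the shape entropy -/

/-- The number of nodes with `k`-th order shape history `z`. -/
def FullBinaryTree.histCount (b : FullBinaryTree) (k : ℕ) (z : List Bool) : ℕ :=
  (b.nodes []).countP fun v => kHistory k v.1 = z

/-- The number of nodes with `k`-th order shape history `z` and type `i`. -/
def FullBinaryTree.histTypeCount (b : FullBinaryTree) (k : ℕ) (z : List Bool) (i : ℕ) : ℕ :=
  (b.nodes []).countP fun v => kHistory k v.1 = z ∧ v.2 = i

/-- The empirical probability of type `i` after the history `h`, mixed with a uniform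
distribution of weight `1 / (2 B)` on four events. -/
noncomputable def FullBinaryTree.typeProb (b : FullBinaryTree) (k B : ℕ) (h : List Bool) (i : ℕ) :
    ℝ :=
  (1 - (B : ℝ)⁻¹ / 2) *
    ((b.histTypeCount k (kHistory k h) i : ℝ) / b.histCount k (kHistory k h)) + (B : ℝ)⁻¹ / 8

/-- The costs given by the empirical distribution of node types in `b`. -/
noncomputable def entropyModel (b : FullBinaryTree) (k B : ℕ) : CostModel where
  leaf h := -Real.logb 2 (b.typeProb k B h 0)
  inner h := -Real.logb 2 (b.typeProb k B h 2)
  cut := Real.logb 2 (8 * B)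

section

variable (b : FullBinaryTree) (k : ℕ) {B : ℕ}

theorem FullBinaryTree.histTypeCount_add_le (z : List Bool) :
    b.histTypeCount k z 0 + b.histTypeCount k z 2 ≤ b.histCount k z := by
  rw [histTypeCount, histTypeCount, histCount]
  induction b.nodes [] with
  | nil => simp
  | cons v l ih =>
    simp only [List.countP_cons, Bool.decide_and, Bool.and_eq_true, decide_eq_true_eq] at ih ⊢
    by_cases hz : kHistory k v.1 = z
    · simp only [hz, true_and, if_true]
      split_ifs <;> omega
    · simpa [hz] using ih

theorem FullBinaryTree.ratio_add_le_one (z : List Bool) :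
    (b.histTypeCount k z 0 : ℝ) / b.histCount k z + (b.histTypeCount k z 2 : ℝ) / b.histCount k z
      ≤ 1 := by
  rw [← add_div]
  refine div_le_one_of_le₀ ?_ (Nat.cast_nonneg _)
  exact_mod_cast b.histTypeCount_add_le k z

theorem inv_natCast_mem (hB : 1 ≤ B) : 0 < (B : ℝ)⁻¹ ∧ (B : ℝ)⁻¹ ≤ 1 := by
  have : (1 : ℝ) ≤ B := by exact_mod_cast hB
  exact ⟨by positivity, inv_le_one_of_one_le₀ this⟩

/-- The uniform part keeps all costs finite, even for histories that do not occur in `b`, where the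
empirical ratio is `0 / 0 = 0`. This matters since the cheapest description of a shape may use any
history. -/
theorem FullBinaryTree.typeProb_pos (hB : 1 ≤ B) (h : List Bool) (i : ℕ) :
    0 < b.typeProb k B h i := by
  obtain ⟨h0, h1⟩ := inv_natCast_mem hB
  have : 0 ≤ 1 - (B : ℝ)⁻¹ / 2 := by linarith
  rw [typeProb]
  positivity

/-- The mixture gives `(1 - 1/(2B)) + 2/(8B)` at most; the missing `1/(4B)` is exactly the room for
the two kinds of cuts, of probability `1/(8B)` each. -/
theorem FullBinaryTree.typeProb_add_le (hB : 1 ≤ B) (h : List Bool) :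
    b.typeProb k B h 0 + b.typeProb k B h 2 ≤ 1 - (B : ℝ)⁻¹ / 4 := by
  obtain ⟨h0, h1⟩ := inv_natCast_mem hB
  have := b.ratio_add_le_one k (kHistory k h)
  rw [typeProb, typeProb]
  nlinarith

theorem entropyModel_kraft (hB : 1 ≤ B) : (entropyModel b k B).Kraft := by
  intro h
  obtain ⟨h0, h1⟩ := inv_natCast_mem hB
  have hB' : (0 : ℝ) < B := by exact_mod_cast hB
  simp only [entropyModel, neg_neg]
  rw [Real.rpow_logb two_pos (by norm_num) (b.typeProb_pos k hB h 0),
    Real.rpow_logb two_pos (by norm_num) (b.typeProb_pos k hB h 2), Real.rpow_neg two_pos.le,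
    Real.rpow_logb two_pos (by norm_num) (by positivity), mul_inv]
  have := b.typeProb_add_le k hB h
  linarith

theorem entropyModel_hasOrder : (entropyModel b k B).HasOrder k := by
  intro h
  simp [entropyModel, FullBinaryTree.typeProb, kHistory_kHistory]

theorem entropyModel_leaf_nonneg (hB : 1 ≤ B) (h : List Bool) :
    0 ≤ (entropyModel b k B).leaf h := by
  have h0 := (inv_natCast_mem hB).1
  have h1 := b.typeProb_add_le k hB h
  have h2 := b.typeProb_pos k hB h 2
  exact neg_nonneg.2 (Real.logb_nonpos one_lt_two (b.typeProb_pos k hB h 0).le (by linarith))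

theorem entropyModel_inner_nonneg (hB : 1 ≤ B) (h : List Bool) :
    0 ≤ (entropyModel b k B).inner h := by
  have h0 := (inv_natCast_mem hB).1
  have h1 := b.typeProb_add_le k hB h
  have h2 := b.typeProb_pos k hB h 0
  exact neg_nonneg.2 (Real.logb_nonpos one_lt_two (b.typeProb_pos k hB h 2).le (by linarith))

theorem entropyModel_cut_nonneg (hB : 1 ≤ B) : 0 ≤ (entropyModel b k B).cut := by
  have : (1 : ℝ) ≤ B := by exact_mod_cast hB
  exact Real.logb_nonneg one_lt_two (by linarith)

/-- Mixing shrinks an empirical probability by a factor of at least `1 - 1/(2B) ≥ 2 ^ (-1/B)`, a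
loss of at most `1/B` bit. -/
theorem neg_logb_typeProb_le (hB : 1 ≤ B) (h : List Bool) (i : ℕ)
    (hi : 0 < b.histTypeCount k (kHistory k h) i) :
    -Real.logb 2 (b.typeProb k B h i) ≤ Real.logb 2
      ((b.histCount k (kHistory k h) : ℝ) / b.histTypeCount k (kHistory k h) i) + (B : ℝ)⁻¹ := by
  obtain ⟨h0, h1⟩ := inv_natCast_mem hB
  have hc : 0 < b.histCount k (kHistory k h) := by
    refine lt_of_lt_of_le hi (List.countP_mono_left fun v _ hv => ?_)
    simp only [decide_eq_true_eq] at hv ⊢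
    exact hv.1
  have hp : (0 : ℝ) < (b.histTypeCount k (kHistory k h) i : ℝ) / b.histCount k (kHistory k h) := by
    positivity
  -- Bernoulli's inequality for exponents in `[0, 1]`, applied to `(1 - 1/2) ^ (1/B)`.
  have hpow : (2 : ℝ) ^ (-(B : ℝ)⁻¹) ≤ 1 - (B : ℝ)⁻¹ / 2 := by
    have := rpow_one_add_le_one_add_mul_self (s := -(1 / 2)) (by norm_num) h0.le h1
    rw [Real.rpow_neg two_pos.le, ← Real.inv_rpow two_pos.le]
    norm_num at this ⊢
    linarith
  have hle : (2 : ℝ) ^ (-(B : ℝ)⁻¹) *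
      ((b.histTypeCount k (kHistory k h) i : ℝ) / b.histCount k (kHistory k h)) ≤
        b.typeProb k B h i := by
    rw [FullBinaryTree.typeProb]
    have := mul_le_mul_of_nonneg_right hpow hp.le
    linarith
  have hlog := Real.logb_le_logb_of_le one_lt_two (by positivity) hle
  rw [Real.logb_mul (by positivity) hp.ne', Real.logb_rpow two_pos (by norm_num)] at hlog
  rw [← inv_div, Real.logb_inv]
  linarith

theorem CostModel.total_eq_sum_nodes (φ : CostModel) : ∀ h, φ.total h b =
    ((b.nodes h).map fun v => if v.2 = 0 then φ.leaf v.1 else φ.inner v.1).sum := by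
  induction b with
  | leaf => simp [total, FullBinaryTree.nodes]
  | node l r ihl ihr =>
    intro h
    simp [total, FullBinaryTree.nodes, ihl, ihr, add_assoc]

theorem FullBinaryTree.type_of_mem_nodes :
    ∀ h, ∀ v ∈ b.nodes h, v.2 = 0 ∨ v.2 = 2 := by
  induction b with
  | leaf => simp [nodes]
  | node l r ihl ihr =>
    intro h v hv
    rw [nodes, List.mem_cons, List.mem_append] at hv
    rcases hv with rfl | hv | hv
    · exact Or.inr rfl
    · exact ihl _ v hv
    · exact ihr _ v hv

/-- Grouping nodes by history and type turns a cost per node into the double sum that defines the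
shape entropy. -/
theorem sum_map_kHistory (F : List Bool → ℕ → ℝ) (l : List (List Bool × ℕ))
    (hl : ∀ v ∈ l, v.2 = 0 ∨ v.2 = 2) :
    (l.map fun v => F (kHistory k v.1) v.2).sum = ∑ z : Fin k → Bool, ∑ i ∈ ({0, 2} : Finset ℕ),
      (l.countP fun v => kHistory k v.1 = List.ofFn z ∧ v.2 = i : ℕ) * F (List.ofFn z) i := by
  induction l with
  | nil => simp
  | cons v l ih =>
    rw [List.map_cons, List.sum_cons, ih fun v' hv' => hl v' (by simp [hv'])]
    simp only [List.countP_cons, Nat.cast_add, add_mul, Finset.sum_add_distrib, decide_eq_true_eq]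
    rw [add_comm, add_right_inj]
    obtain ⟨z, hz⟩ : ∃ z : Fin k → Bool, List.ofFn z = kHistory k v.1 := by
      refine ⟨fun i => (kHistory k v.1)[i]'(by rw [length_kHistory]; exact i.2), ?_⟩
      apply List.ext_getElem
      · simp [length_kHistory]
      · intro i _ _
        simp
    have hv : v.2 ∈ ({0, 2} : Finset ℕ) := by simpa using hl v (by simp)
    rw [Finset.sum_eq_single z, Finset.sum_eq_single v.2]
    · simp [hz]
    · intro i _ hi
      simp [hi.symm]
    · exact fun h => absurd hv h
    · intro z' _ hz'
      refine Finset.sum_eq_zero fun i _ => ?_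
      rw [if_neg, Nat.cast_zero, zero_mul]
      rintro ⟨h, -⟩
      exact hz' (List.ofFn_injective (h.symm.trans hz.symm))
    · exact fun h => absurd (Finset.mem_univ _) h

theorem entropyModel_total_le (hB : 1 ≤ B) : (entropyModel b k B).total [] b ≤
    b.shapeEntropy k + (b.nodes []).length * (B : ℝ)⁻¹ := by
  have hsum : b.shapeEntropy k = ((b.nodes []).map fun v => Real.logb 2
      ((b.histCount k (kHistory k v.1) : ℝ) / b.histTypeCount k (kHistory k v.1) v.2)).sum := by
    rw [sum_map_kHistory k
      (fun z i => Real.logb 2 ((b.histCount k z : ℝ) / b.histTypeCount k z i)) _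
      (b.type_of_mem_nodes [])]
    rfl
  rw [CostModel.total_eq_sum_nodes, hsum, ← nsmul_eq_mul, ← List.length_map (as := b.nodes [])
    (fun _ => (B : ℝ)⁻¹), ← List.sum_replicate, ← List.map_const', List.map_map,
    ← List.sum_map_add]
  refine List.sum_le_sum fun v hv => ?_
  have hpos : 0 < b.histTypeCount k (kHistory k v.1) v.2 :=
    List.countP_pos_iff.2 ⟨v, hv, by simp⟩
  have := neg_logb_typeProb_le b k hB v.1 v.2 hpos
  rcases b.type_of_mem_nodes [] v hv with h | h <;> rw [h] at this ⊢ <;>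
    simpa [entropyModel] using this

end

theorem length_nodes_fcns (f : List OrdinalTree) :
    ∀ h, ((fcns f).nodes h).length = 2 * OrdinalTree.sizeForest f + 1 := by
  induction f using forest_induction with
  | nil => simp [fcns, FullBinaryTree.nodes, OrdinalTree.sizeForest]
  | cons f g hf hg =>
    intro h
    simp only [fcns, FullBinaryTree.nodes, List.length_cons, List.length_append, hf, hg,
      OrdinalTree.sizeForest, OrdinalTree.size]
    ring

end Hypersuccinct
namespace Hypersuccinct

/-! ### Lengths of the parts of the code -/

namespace OrdinalTree

theorem length_bpForest (f : List OrdinalTree) : (bpForest f).length = 2 * sizeForest f := by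
  induction f using forest_induction with
  | nil => rfl
  | cons f g hf hg =>
    simp only [bpForest, bp, List.cons_append, List.length_cons, List.length_append, hf, hg,
      sizeForest, size, List.length_nil]
    ring

theorem length_bp (t : OrdinalTree) : t.bp.length = 2 * t.size := by
  have := length_bpForest [t]
  simpa [bpForest, sizeForest] using this

/-- The closing parenthesis after the forest acts as a sentinel that makes the parse unique. -/
theorem bpForest_append_inj (f : List OrdinalTree) : ∀ f' r r',
    bpForest f ++ false :: r = bpForest f' ++ false :: r' → f = f' ∧ r = r' := by
  induction f using forest_induction with
  | nil =>
    rintro (_ | ⟨⟨f'⟩, g'⟩) r r' h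
    · simpa [bpForest] using h
    · simp [bpForest, bp] at h
  | cons f g hf hg =>
    rintro (_ | ⟨⟨f'⟩, g'⟩) r r' h
    · simp [bpForest, bp] at h
    · simp only [bpForest, bp, List.cons_append, List.append_assoc, List.cons.injEq, true_and,
        List.nil_append] at h
      obtain ⟨rfl, hr⟩ := hf _ _ _ h
      obtain ⟨rfl, hr'⟩ := hg _ _ _ hr
      exact ⟨rfl, hr'⟩

theorem bp_append_inj {s s' : OrdinalTree} {r r' : List Bool} (h : s.bp ++ r = s'.bp ++ r') :
    s = s' := by
  obtain ⟨f⟩ := s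
  obtain ⟨f'⟩ := s'
  simp only [bp, List.cons_append, List.append_assoc, List.cons.injEq, true_and,
    List.nil_append] at h
  rw [(bpForest_append_inj _ _ _ _ h).1]

/-- Balanced-parenthesis sequences of trees are prefix-free, so padding them to length `2 * n` stays
injective. -/
theorem card_le_of_size_le {n : ℕ} (S : Finset OrdinalTree) (hS : ∀ s ∈ S, s.size ≤ n) :
    S.card ≤ 2 ^ (2 * n) := by
  let pad : OrdinalTree → List Bool := fun s => s.bp ++ List.replicate (2 * n - 2 * s.size) false
  have hlen : ∀ s ∈ S, (pad s).length = 2 * n := by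
    intro s hs
    have := hS s hs
    simp only [pad, List.length_append, length_bp, List.length_replicate]
    omega
  have : S.card ≤ ((Finset.univ : Finset (Fin (2 * n) → Bool)).image List.ofFn).card := by
    refine Finset.card_le_card_of_injOn pad ?_ fun s _ s' _ h => bp_append_inj h
    intro s hs
    have hl := hlen s hs
    rw [Finset.coe_image]
    refine ⟨fun i => (pad s)[i]'(by rw [hl]; exact i.2), Finset.mem_coe.2 (Finset.mem_univ _), ?_⟩
    apply List.ext_getElem
    · simp [hl]
    · intro i _ _
      simp
  exact this.trans (Finset.card_image_le.trans (by simp))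

end OrdinalTree

theorem length_eliasGamma_le (n : ℕ) : (eliasGamma n).length ≤ 2 * Nat.log 2 n + 1 := by
  rw [eliasGamma, List.length_append, List.length_replicate, List.length_reverse,
    Nat.size_eq_bits_len]
  have : n.size ≤ Nat.log 2 n + 1 := Nat.size_le.2 (Nat.lt_pow_succ_log_self one_lt_two n)
  omega

theorem log_two_le_pred (n : ℕ) : Nat.log 2 (n + 1) ≤ n := by
  have h1 := Nat.pow_log_le_self 2 (x := n + 1) (by omega)
  have h2 := (Nat.log 2 (n + 1)).lt_two_pow_self
  omega

theorem length_eliasGamma_le_two_mul (n : ℕ) : (eliasGamma n).length ≤ 2 * n + 1 := by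
  have h := length_eliasGamma_le n
  cases n with
  | zero => simpa using h
  | succ n =>
    have := log_two_le_pred n
    omega

/-- The flag bit is the only loss, as the fallback replaces only codewords at least as long as its
own body. The second bound keeps the code table small even if some Huffman codewords are very long.
-/
theorem length_lengthRestrict_le (C : OrdinalTree → List Bool) (s : OrdinalTree) :
    (lengthRestrict C s).length ≤ (C s).length + 1 ∧
      (lengthRestrict C s).length ≤ 4 * s.size + 2 := by
  have hg := length_eliasGamma_le (s.size + 1)
  have hl := log_two_le_pred s.size
  rw [lengthRestrict]
  split
  · simp only [List.length_cons, List.length_append, OrdinalTree.length_bp]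
    omega
  · simp only [List.length_cons]
    omega

theorem length_codeTable_le {B : ℕ} (hB : 1 ≤ B) (C : OrdinalTree → List Bool)
    (S : List OrdinalTree) (hS : ∀ s ∈ S, s.size ≤ 2 * B) :
    (codeTable (lengthRestrict C) S).length ≤ 2 * S.length + 1 + S.length * (42 * B) := by
  rw [codeTable, List.length_append, List.length_flatMap]
  refine add_le_add (length_eliasGamma_le_two_mul _) ?_
  rw [← smul_eq_mul, ← List.length_map (as := S) fun s => (eliasGamma
    (lengthRestrict C s).length ++ lengthRestrict C s ++ eliasGamma s.size ++ s.bp).length]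
  refine List.sum_le_card_nsmul _ _ fun x hx => ?_
  obtain ⟨s, hs, rfl⟩ := List.mem_map.1 hx
  have h1 := (length_lengthRestrict_le C s).2
  have h2 := hS s hs
  have h3 := length_eliasGamma_le_two_mul (lengthRestrict C s).length
  have h4 := length_eliasGamma_le_two_mul s.size
  simp only [List.length_append, OrdinalTree.length_bp]
  -- The four fields take at most `16B + 5`, `8B + 2`, `4B + 1` and `4B` bits, which fits into `42B`
  -- as `B ≥ 1`.
  omega

mutual
theorem TopTree.size_skeleton : ∀ T : TopTree, T.skeleton.size = T.dfs.length
  | .node e s p cs => by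
    rw [skeleton, OrdinalTree.size, dfs, List.length_cons, sizeForest_skeletons cs, add_comm]
theorem TopTree.sizeForest_skeletons :
    ∀ Ts : List TopTree, OrdinalTree.sizeForest (skeletons Ts) = (dfsForest Ts).length
  | [] => rfl
  | T :: Ts => by
    rw [skeletons, OrdinalTree.sizeForest, dfsForest, List.length_append, size_skeleton T,
      sizeForest_skeletons Ts]
end

theorem length_portalBits (w : ℕ) (p : Option (ℕ × ℕ)) : (portalBits w p).length = 2 * w := by
  simp [portalBits, fixedWidth, two_mul]

theorem EdgeType.length_bits (e : EdgeType) : e.bits.length = 3 := by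
  cases e <;> rfl

/-- The length of the code: the contributions of the micro trees, and the rest. -/
theorem length_encodeWith_le (T : CodeTree OrdinalTree) (t : OrdinalTree)
    (hB : 1 ≤ blockParam t.size) :
    (encodeWith T t).length ≤ 2 * Nat.log 2 t.size + 5 +
      44 * (blockParam t.size * 2 ^ (4 * blockParam t.size)) +
      ((microShapes t).map fun s => (T.code s).length +
        (8 + 2 * Nat.clog 2 (2 * blockParam t.size + 1))).sum := by
  have hsize : ∀ s ∈ (microShapes t).dedup, s.size ≤ 2 * blockParam t.size := fun s hs =>
    size_le_of_mem_shapes_topTier hB t s (Multiset.mem_coe.2 (List.mem_dedup.1 hs))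
  have hcard : (microShapes t).dedup.length ≤ 2 ^ (4 * blockParam t.size) := by
    have := OrdinalTree.card_le_of_size_le (microShapes t).toFinset
      (n := 2 * blockParam t.size) fun s hs => hsize s (List.mem_dedup.2 (List.mem_toFinset.1 hs))
    rw [List.card_toFinset] at this
    refine this.trans (le_of_eq ?_)
    congr 1
    ring
  have htable := length_codeTable_le hB T.code _ hsize
  have hcard' := Nat.mul_le_mul_left (blockParam t.size) hcard
  have hcard'' : (microShapes t).dedup.length ≤
      blockParam t.size * (microShapes t).dedup.length := Nat.le_mul_of_pos_left _ hB
  have hn := length_eliasGamma_le t.size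
  have hm := length_eliasGamma_le_two_mul (microTrees t).length
  have htop : (topTierTree t).bp.length = 2 * ((microTrees t).length + 1) := by
    rw [OrdinalTree.length_bp, topTierTree, OrdinalTree.size, TopTree.sizeForest_skeletons,
      add_comm]
    rfl
  have hcode : ((microShapes t).map fun s => (lengthRestrict T.code s).length).sum ≤
      ((microShapes t).map fun s => (T.code s).length + 1).sum :=
    List.sum_le_sum fun s _ => (length_lengthRestrict_le T.code s).1
  have hlen : (microShapes t).length = (microTrees t).length := List.length_map _
  simp only [List.sum_map_add, List.map_const', List.sum_replicate, smul_eq_mul, hlen] at hcode ⊢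
  simp only [encodeWith, List.length_append, List.length_flatMap, length_portalBits,
    EdgeType.length_bits, List.map_const', List.sum_replicate, smul_eq_mul, htop]
  rw [mul_comm _ (42 * _), mul_assoc] at htable
  rw [mul_add (microTrees t).length 8]
  -- Per micro tree: 2 bits from the gamma code of their number, 2 from the top tier, 1 flag bit and
  -- 3 for the edge type give 8, besides the portal. The constant 5 collects the single bits of
  -- three gamma codes and the dummy root; 44 is 42 plus 2 for the number of table entries.
  omega

end Hypersuccinct
namespace Hypersuccinct

/-! ### The length of the code -/

theorem Annotation.cost_nonneg {φ : CostModel} (h0 : ∀ h, 0 ≤ φ.leaf h) (h2 : ∀ h, 0 ≤ φ.inner h)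
    (hc : 0 ≤ φ.cut) (A : Annotation) : ∀ h, 0 ≤ A.cost φ h := by
  induction A with
  | leaf => exact h0
  | halt => exact fun _ => hc
  | node l r ihl ihr => exact fun h => add_nonneg (add_nonneg (h2 h) (ihl _)) (ihr _)
  | skip r ih => exact fun h => add_nonneg hc (ih _)

/-- Huffman optimality meets the decomposition bound. `D` stands for the fixed number of further
bits per micro tree; counting it in the weight of a shape also bounds the number of micro trees,
with no separate argument. -/
theorem sum_length_code_le {t : OrdinalTree} {T : CodeTree OrdinalTree}
    (hT : IsHuffmanTree (microShapes t) T) (hB : 1 ≤ blockParam t.size) (k D : ℕ) :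
    ∃ N : ℕ, blockParam t.size * N ≤ 18 * t.size + blockParam t.size ∧
      (((microShapes t).map fun s => (T.code s).length + D).sum : ℝ) ≤
        t.shapeEntropy k + (2 * t.size + 1) * (blockParam t.size : ℝ)⁻¹ +
          (k + 1 + D + Real.logb 2 (8 * blockParam t.size)) * N := by
  obtain ⟨f⟩ := t
  generalize hn : (OrdinalTree.node f).size = n at *
  have h0 := entropyModel_leaf_nonneg (fcns [.node f]) k hB
  have h2 := entropyModel_inner_nonneg (fcns [.node f]) k hB
  have hc := entropyModel_cut_nonneg (fcns [.node f]) k hB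
  have hlen := entropyModel_total_le (fcns [.node f]) k hB
  have hkraft := CostModel.sum_length_le_one (entropyModel_kraft (fcns [.node f]) k hB)
    (entropyModel_hasOrder (fcns [.node f]) k) (microShapes (.node f)).toFinset
  have hcut : (entropyModel (fcns [.node f]) k (blockParam n)).cut =
    Real.logb 2 (8 * blockParam n) := rfl
  generalize entropyModel (fcns [.node f]) k (blockParam n) = φ at *
  -- `K` is made of `k` bits of history, `1` for rounding, the `D` further bits, and the cost of a
  -- cut.
  have hadm : Admissible φ (fun s => φ.length k s + D) (k + 1 + D + φ.cut) :=
    { leaf_nonneg := h0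
      inner_nonneg := h2
      weight_nonneg := fun s => by positivity
      nonneg := by positivity
      cut_le := le_add_of_nonneg_left (by positivity)
      weight_le := fun h A => by
        have := φ.length_le k h A (A.cost_nonneg h0 h2 hc h)
        linarith }
  obtain ⟨N, hN, hle⟩ := weightSum_topTier_le hadm (B := blockParam n) f []
  rw [hn] at hN
  refine ⟨N, hN, ?_⟩
  have hhuff := hT.sum_length_code_le (φ.length k) hkraft
  have hsum : weightSum (fun s => (φ.length k s : ℝ) + D)
      (shapes (topTier (blockParam n) (.node f))) =
        (((microShapes (.node f)).map fun s => φ.length k s + D).sum : ℕ) := by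
    rw [Nat.cast_list_sum, List.map_map, weightSum, shapes, Multiset.map_coe, Multiset.sum_coe,
      microShapes, microTrees, hn]
    simp [Function.comp_def]
  have hnat : ((microShapes (.node f)).map fun s => (T.code s).length + D).sum ≤
      ((microShapes (.node f)).map fun s => φ.length k s + D).sum := by
    rw [List.sum_map_add, List.sum_map_add]
    exact Nat.add_le_add_right hhuff _
  have htot : φ.total [] (fcns [.node f]) =
      φ.inner [] + φ.total [false] (fcns f) + φ.leaf [true] := by
    simp [fcns, CostModel.total]
  have hnodes : (((fcns [.node f]).nodes []).length : ℝ) = 2 * n + 1 := by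
    rw [length_nodes_fcns, ← hn]
    simp [OrdinalTree.sizeForest]
  rw [hnodes] at hlen
  rw [hsum, List.nil_append, hcut] at hle
  have hcast : (((microShapes (.node f)).map fun s => (T.code s).length + D).sum : ℝ) ≤
      (((microShapes (.node f)).map fun s => φ.length k s + D).sum : ℕ) := by
    exact_mod_cast hnat
  have := h2 []
  have := h0 [true]
  rw [OrdinalTree.shapeEntropy]
  linarith

theorem clog_le_logb_add_one {B : ℕ} (hB : 1 ≤ B) :
    (Nat.clog 2 (2 * B + 1) : ℝ) ≤ Real.logb 2 (8 * B) + 1 := by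
  have hB' : (1 : ℝ) ≤ B := by exact_mod_cast hB
  have h1 : (⌈Real.logb 2 ((2 * B + 1 : ℕ) : ℝ)⌉₊ : ℝ) < Real.logb 2 ((2 * B + 1 : ℕ) : ℝ) + 1 := by
    refine Nat.ceil_lt_add_one (Real.logb_nonneg one_lt_two ?_)
    push_cast
    linarith
  have h2 := Real.natCeil_logb_natCast 2 (2 * B + 1)
  push_cast at h1 h2
  rw [h2] at h1
  have h3 : Real.logb 2 (2 * B + 1) ≤ Real.logb 2 (8 * B) :=
    Real.logb_le_logb_of_le one_lt_two (by linarith) (by linarith)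
  linarith

/-- A bound on the length of the code in terms of the block size. -/
theorem length_encodeWith_le_shapeEntropy {t : OrdinalTree} {T : CodeTree OrdinalTree}
    (hT : IsHuffmanTree (microShapes t) T) {B : ℕ} (hBt : blockParam t.size = B) (hB : 1 ≤ B)
    (hBn : B ≤ t.size) (k : ℕ) :
    ((encodeWith T t).length : ℝ) ≤ t.shapeEntropy k + (2 * Real.logb 2 t.size + 5) +
      44 * (B * 2 ^ (4 * B)) +
      (3 + 19 * (k + 11 + 3 * Real.logb 2 (8 * B))) * (t.size / B) := by
  subst hBt
  set B := blockParam t.size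
  have hB' : (1 : ℝ) ≤ B := by exact_mod_cast hB
  have hn' : (B : ℝ) ≤ t.size := by exact_mod_cast hBn
  obtain ⟨N, hN, hsum⟩ := sum_length_code_le hT hB k (8 + 2 * Nat.clog 2 (2 * B + 1))
  have hlen := length_encodeWith_le T t hB
  have hlen' : ((encodeWith T t).length : ℝ) ≤ 2 * Nat.log 2 t.size + 5 + 44 * (B * 2 ^ (4 * B)) +
      (((microShapes t).map fun s => (T.code s).length +
        (8 + 2 * Nat.clog 2 (2 * B + 1))).sum : ℕ) := by
    exact_mod_cast hlen
  have hlog : (Nat.log 2 t.size : ℝ) ≤ Real.logb 2 t.size := by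
    exact_mod_cast Real.natLog_le_logb t.size 2
  have hclog := clog_le_logb_add_one hB
  have hNB : (N : ℝ) ≤ 19 * (t.size / B) := by
    rw [← mul_div_assoc, le_div_iff₀ (by linarith)]
    have : (B : ℝ) * N ≤ 18 * t.size + B := by exact_mod_cast hN
    linarith
  have h1 : (2 * t.size + 1) * (B : ℝ)⁻¹ ≤ 3 * (t.size / B) := by
    rw [div_eq_mul_inv, ← mul_assoc]
    exact mul_le_mul_of_nonneg_right (by linarith) (by positivity)
  have hlogB : 0 ≤ Real.logb 2 (8 * B) := Real.logb_nonneg one_lt_two (by linarith)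
  -- `11 = 1 + 8 + 2`, where the 2 comes from rounding up both portal widths; `3` counts the cut and
  -- the two portal numbers.
  have h2 : (k + 1 + ((8 + 2 * Nat.clog 2 (2 * B + 1) : ℕ) : ℝ) + Real.logb 2 (8 * B)) * N ≤
      (k + 11 + 3 * Real.logb 2 (8 * B)) * (19 * (t.size / B)) := by
    refine mul_le_mul ?_ hNB (Nat.cast_nonneg _) (by positivity)
    push_cast
    linarith
  rw [add_mul]
  push_cast at hsum h2 hlen' ⊢
  linarith

theorem exists_errorBound :
    ∃ c : ℝ, ∀ (n k B : ℕ), 3 ≤ n → B = ⌈Real.logb 2 n / 8⌉₊ →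
      (2 * Real.logb 2 n + 5) + 44 * (B * 2 ^ (4 * B)) +
        (3 + 19 * (k + 11 + 3 * Real.logb 2 (8 * B))) * ((n : ℝ) / B) ≤
      c * (((n : ℝ) * Real.log (Real.log n) + k * n) / Real.log n) := by
  have hlog3 : 1 < Real.log 3 := by
    rw [Real.lt_log_iff_exp_lt (by norm_num)]
    exact Real.exp_one_lt_d9.trans (by norm_num)
  have hδ : 0 < Real.log (Real.log 3) := Real.log_pos hlog3
  -- `1064 = 8 * (114 + 19)` covers the terms in `log log n` and `k`. `26192 = 144 + 22528 + 8 *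
  -- 440` collects the terms linear in `n`, which are at most `n log log n` over `log log 3`; this
  -- is positive because `3 > e`.
  refine ⟨1064 + 26192 / Real.log (Real.log 3), fun n k B hn hB => ?_⟩
  have hn' : (3 : ℝ) ≤ n := by exact_mod_cast hn
  have hn0 : (0 : ℝ) < n := by linarith
  set l := Real.log n with hl
  have hl3 : Real.log 3 ≤ l := Real.log_le_log (by norm_num) hn'
  have hl1 : 1 < l := hlog3.trans_le hl3
  have hll : Real.log (Real.log 3) ≤ Real.log l := Real.log_le_log (by linarith) hl3
  set δ := Real.log (Real.log 3)
  have hlogn : Real.logb 2 n = l / Real.log 2 := rfl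
  have h2a := Real.log_two_gt_d9
  have h2b := Real.log_two_lt_d9
  have hlogn_le : Real.logb 2 n ≤ 2 * l := by
    rw [hlogn, div_le_iff₀ (by linarith)]
    nlinarith
  have hlogn_ge : l ≤ Real.logb 2 n := by
    rw [hlogn, le_div_iff₀ (by linarith)]
    nlinarith
  have hBge : l / 8 ≤ B := by
    have := Nat.le_ceil (Real.logb 2 n / 8)
    rw [← hB] at this
    linarith
  have hBlt : (B : ℝ) < Real.logb 2 n / 8 + 1 := by
    rw [hB]
    exact Nat.ceil_lt_add_one (by linarith)
  have hBpos : (0 : ℝ) < B := by linarith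
  have hB2 : (B : ℝ) ≤ 2 * l := by linarith
  have hquot : (n : ℝ) / B ≤ 8 * n / l := by
    rw [div_le_div_iff₀ hBpos (by linarith)]
    nlinarith
  have hlogB : Real.logb 2 (8 * B) ≤ 4 + 2 * Real.log l := by
    calc Real.logb 2 (8 * B) ≤ Real.logb 2 (2 ^ (4 : ℝ) * l) := by
          refine Real.logb_le_logb_of_le one_lt_two (by positivity) ?_
          norm_num
          linarith
      _ = 4 + Real.log l / Real.log 2 := by
          rw [Real.logb_mul (by positivity) (by linarith), Real.logb_rpow two_pos (by norm_num)]
          rfl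
      _ ≤ 4 + 2 * Real.log l := by
          rw [add_le_add_iff_left, div_le_iff₀ (by linarith)]
          nlinarith
  have hroot : l * l ≤ 16 * Real.sqrt n := by
    have h := Real.log_le_rpow_div hn0.le (ε := 1 / 4) (by norm_num)
    have h' : l ≤ 4 * (n : ℝ) ^ (1 / 4 : ℝ) := by
      rw [hl]
      linarith
    have hsq : (n : ℝ) ^ (1 / 4 : ℝ) * (n : ℝ) ^ (1 / 4 : ℝ) = Real.sqrt n := by
      rw [← Real.rpow_add hn0, Real.sqrt_eq_rpow]
      norm_num
    nlinarith
  -- This is where the factor `1/8` in the block size matters: `4B < (lg n) / 2 + 4` keeps the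
  -- number of shapes at `O(√n)`.
  have hpow : (2 : ℝ) ^ (4 * B) ≤ 16 * Real.sqrt n := by
    have hexp : ((4 * B : ℕ) : ℝ) ≤ 4 + Real.logb 2 n * (1 / 2) := by
      push_cast
      linarith
    calc (2 : ℝ) ^ (4 * B) = (2 : ℝ) ^ ((4 * B : ℕ) : ℝ) := (Real.rpow_natCast _ _).symm
      _ ≤ (2 : ℝ) ^ (4 + Real.logb 2 n * (1 / 2)) :=
          Real.rpow_le_rpow_of_exponent_le one_le_two hexp
      _ = 16 * Real.sqrt n := by
          rw [Real.rpow_add two_pos, Real.rpow_mul two_pos.le,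
            Real.rpow_logb two_pos (by norm_num) hn0, Real.sqrt_eq_rpow]
          norm_num
  have hsqrt : Real.sqrt n * Real.sqrt n = n := Real.mul_self_sqrt hn0.le
  have hsqrt_le : Real.sqrt n ≤ n := by
    rw [Real.sqrt_le_left hn0.le]
    nlinarith
  have hfirst : (2 * Real.logb 2 n + 5) * l ≤ 144 * n := by nlinarith
  have hsecond : 44 * (B * 2 ^ (4 * B)) * l ≤ 22528 * n := by
    have h1 : (B : ℝ) * 2 ^ (4 * B) ≤ 2 * l * (16 * Real.sqrt n) :=
      mul_le_mul hB2 hpow (by positivity) (by linarith)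
    have h2 : l * l * Real.sqrt n ≤ 16 * n := by
      calc l * l * Real.sqrt n ≤ 16 * Real.sqrt n * Real.sqrt n :=
            mul_le_mul_of_nonneg_right hroot (Real.sqrt_nonneg _)
        _ = 16 * n := by rw [mul_assoc, hsqrt]
    calc 44 * (B * 2 ^ (4 * B)) * l ≤ 44 * (2 * l * (16 * Real.sqrt n)) * l :=
          mul_le_mul_of_nonneg_right (by linarith) (by linarith)
      _ = 1408 * (l * l * Real.sqrt n) := by ring
      _ ≤ 22528 * n := by linarith
  have hthird : (3 + 19 * (k + 11 + 3 * Real.logb 2 (8 * B))) * ((n : ℝ) / B) * l ≤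
      (440 + 19 * k + 114 * Real.log l) * (8 * n) := by
    have hk : (0 : ℝ) ≤ k := Nat.cast_nonneg k
    calc (3 + 19 * (k + 11 + 3 * Real.logb 2 (8 * B))) * ((n : ℝ) / B) * l
        ≤ (440 + 19 * k + 114 * Real.log l) * (8 * n / l) * l := by
          refine mul_le_mul_of_nonneg_right (mul_le_mul (by linarith) hquot (by positivity) ?_)
            (by linarith)
          linarith
      _ = (440 + 19 * k + 114 * Real.log l) * (8 * n) := by
          rw [mul_assoc, div_mul_cancel₀ _ (by linarith)]
  rw [← mul_div_assoc (1064 + 26192 / δ), le_div_iff₀ (by linarith)]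
  have hδn : (n : ℝ) ≤ n * Real.log l / δ := by
    rw [le_div_iff₀ hδ]
    exact mul_le_mul_of_nonneg_left hll hn0.le
  have hkn : (0 : ℝ) ≤ k * n := by positivity
  have hknδ : 0 ≤ k * n / δ := by positivity
  have hlln : 0 ≤ n * Real.log l := mul_nonneg hn0.le (hδ.le.trans hll)
  have hexpand : (1064 + 26192 / δ) * (n * Real.log l + k * n) =
      1064 * (n * Real.log l) + 1064 * (k * n) + 26192 * (n * Real.log l / δ) +
        26192 * (k * n / δ) := by ring
  rw [hexpand]
  linarith

theorem blockParam_le {n : ℕ} (hn : 3 ≤ n) : 1 ≤ blockParam n ∧ blockParam n ≤ n := by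
  have hn' : (1 : ℝ) < n := by exact_mod_cast (by omega : 1 < n)
  have hpos := Real.logb_pos one_lt_two hn'
  refine ⟨Nat.one_le_iff_ne_zero.2 (Nat.pos_iff_ne_zero.1 (Nat.ceil_pos.2 (by linarith))), ?_⟩
  refine Nat.ceil_le.2 ?_
  have : Real.logb 2 n ≤ n := by
    rw [Real.logb_le_iff_le_rpow one_lt_two (by linarith), Real.rpow_natCast]
    exact_mod_cast n.lt_two_pow_self.le
  linarith

end Hypersuccinct

theorem mainTheorem12 :
    ∃ c : ℝ, ∀ H : Hypersuccinct.OrdinalTree → List Bool, Hypersuccinct.IsHypersuccinctCode H →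
      ∀ (k : ℕ) (t : Hypersuccinct.OrdinalTree), 3 ≤ t.size →
        ((H t).length : ℝ) ≤ t.shapeEntropy k +
          c * (((t.size : ℝ) * Real.log (Real.log t.size) + k * t.size) / Real.log t.size) := by
  obtain ⟨c, hc⟩ := Hypersuccinct.exists_errorBound
  refine ⟨c, fun H hH k t ht => ?_⟩
  obtain ⟨T, hT, hHt⟩ := hH t
  obtain ⟨hB, hBn⟩ := Hypersuccinct.blockParam_le ht
  have h1 := Hypersuccinct.length_encodeWith_le_shapeEntropy hT rfl hB hBn k
  have h2 := hc t.size k _ ht (Eq.refl (Hypersuccinct.blockParam t.size))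
  rw [hHt]
  linarith
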